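/- Let $V$ be a finite dimensional real Euclidean space and let $W$ be a finite group of isometries of $V$ generated by reflections. Let $\mathcal A$ be its reflection arrangement, that is, the set of hyperplanes fixed by some reflection in $W$. Let $\mathcal F$ be the semigroup of faces of $\mathcal A$, that is, the non-empty intersections $\bigcap_{H\in\mathcal A}H^{\sigma_H}$ with $\sigma_H\in\{+,0,-\}$, with the product determined by $\sigma_H(xy)=\sigma_H(x)$ if $\sigma_H(x)\ne0$ and $\sigma_H(xy)=\sigma_H(y)$ otherwise. The support $\operatorname{supp}(x)$ of a face $x$ is the intersection of all hyperplanes of $\mathcal A$ containing $x$, and $\mathcal L=\operatorname{supp}(\mathcal F)$, ordered by inclusion, is the intersection lattice. The set $\mathcal L/W$ of $W$-orbits is ordered by $\mathcal O_X\le\mathcal O_Y$ if and only if $w(X)\subseteq Y$ for some $w\in W$, and the rank of the orbit of $X$ is $\dim X-\dim\bigcap_{H\in\mathcal A}H$. Let $k$ be a field whose characteristic does not divide $|W|$, and let $A=(k\mathcal F)^W$ be the subalgebra of $W$-invariants of the semigroup algebra $k\mathcal F$. For each $X\in\mathcal L$ let $\ell_X\in k\mathcal F$ be a linear combination of faces of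 support $X$ with coefficients summing to $1$, such that $w(\ell_X)=\ell_{w(X)}$ for all $w\in W$. Put $e_X=\ell_X-\sum_{Y>X}\ell_Xe_Y$ (recursively) and $\varepsilon_{\mathcal O}=\sum_{X\in\mathcal O}e_X\in A$ for $\mathcal O\in\mathcal L/W$. The elements $\varepsilon_{\mathcal O}$ form a complete system of primitive orthogonal idempotents of the split basic algebra $A$. So the quiver $\Gamma$ of $A$ has vertex set $\mathcal L/W$, and the number of arrows from $\mathcal O'$ to $\mathcal O$ is $\dim_k\varepsilon_{\mathcal O}\big(\operatorname{rad}(A)/\operatorname{rad}^2(A)\big)\varepsilon_{\mathcal O'}$. **Proposition.** Suppose that $W$ is of type $A_1$, $B_n$, $D_{2n}$, $E_7$, $E_8$, $F_4$, $I_2(2n)$, $H_3$ or $H_4$. Let $\mathcal O,\mathcal O'\in\mathcal L/W$. If the difference between the ranks of $\mathcal O'$ and $\mathcal O$ in $\mathcal L/W$ is odd, then there is no arrow in $\Gamma$ from $\mathcal O'$ to $\mathcal O$. In particular, if $\mathcal O\lessdot\mathcal O'$ (that is, $\mathcal O'$ covers $\mathcal O$ in $\mathcal L/W$), then there is no arrow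 in $\Gamma$ from $\mathcal O'$ to $\mathcal O$. -/

import Mathlib

noncomputable section

namespace FaceQuiver

variable {V : Type*} [NormedAddCommGroup V] [InnerProductSpace ℝ V] [FiniteDimensional ℝ V]

/-- The linear hyperplanes of `V`. -/
def IsHyperplane (H : Submodule ℝ V) : Prop := ∃ u : V, u ≠ 0 ∧ H = (ℝ ∙ u)ᗮ

/-- `W` is generated by a set of reflections of `V`. -/
def IsReflectionGroup (W : Subgroup (V ≃ₗᵢ[ℝ] V)) : Prop :=
  ∃ R : Set (V ≃ₗᵢ[ℝ] V),
    (∀ s ∈ R, ∃ H : Submodule ℝ V, IsHyperplane H ∧ s = H.reflection) ∧ Subgroup.closure R = W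

/-- The reflection arrangement of `W`: the hyperplanes fixed by some reflection in `W`. -/
def arrangement (W : Subgroup (V ≃ₗᵢ[ℝ] V)) : Set (Submodule ℝ V) :=
  {H | IsHyperplane H ∧ H.reflection ∈ W}

/-! ### Chambers, walls and the type of a reflection group -/

/-- The union of the hyperplanes of the arrangement. -/
def hyperplaneUnion (W : Subgroup (V ≃ₗᵢ[ℝ] V)) : Set V :=
  ⋃ H ∈ arrangement W, (H : Set V)

/-- The chambers: connected components of the complement of the hyperplanes. -/
def IsChamber (W : Subgroup (V ≃ₗᵢ[ℝ] V)) (c : Set V) : Prop :=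
  ∃ v ∈ (hyperplaneUnion W)ᶜ, c = connectedComponentIn (hyperplaneUnion W)ᶜ v

/-- The walls of `c`: the `H` in the arrangement such that `H ∩ closure c` spans `H`. -/
def walls (W : Subgroup (V ≃ₗᵢ[ℝ] V)) (c : Set V) : Set (Submodule ℝ V) :=
  {H | H ∈ arrangement W ∧ Submodule.span ℝ ((H : Set V) ∩ closure c) = H}

/-- `W` is of the type given by the Coxeter matrix `M`: for the Coxeter system `(W, S)` with
fundamental chamber some chamber `c`, where `S` consists of the reflections in the walls of `c`,
the orders of the products of two elements of `S` form the matrix `M`. -/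
def HasType {B : Type*} (W : Subgroup (V ≃ₗᵢ[ℝ] V)) (M : CoxeterMatrix B) : Prop :=
  ∃ c : Set V, IsChamber W c ∧ ∃ e : B ≃ walls W c, ∀ i j : B,
    orderOf ((e i : Submodule ℝ V).reflection * (e j : Submodule ℝ V).reflection) = M i j

/-- The Coxeter matrix of type `D_n`: the nodes `0, 1, …, n - 2` form a chain and the node `n - 1`
is joined to the node `n - 3` only. -/
def typeD (n : ℕ) : CoxeterMatrix (Fin n) where
  M := Matrix.of fun i j : Fin n ↦
    if i = j then 1
    else if ((i : ℕ) + 1 = j ∧ (j : ℕ) + 1 < n) ∨ ((j : ℕ) + 1 = i ∧ (i : ℕ) + 1 < n) ∨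
      ((i : ℕ) + 3 = n ∧ (j : ℕ) + 1 = n) ∨ ((j : ℕ) + 3 = n ∧ (i : ℕ) + 1 = n) then 3 else 2
  isSymm := by
    ext i j
    simp only [Matrix.transpose_apply, Matrix.of_apply]
    split_ifs <;> first | rfl | (exfalso; subst_vars; tauto)
  diagonal := by simp
  off_diagonal := by
    intro i j h
    simp only [Matrix.of_apply, if_neg h]
    split_ifs <;> decide

/-- `W` is of type `A_1`, `B_n`, `D_{2n}`, `E_7`, `E_8`, `F_4`, `I_2(2n)`, `H_3` or `H_4`.
(`CoxeterMatrix.I m` is the matrix of type `I_2(m + 2)`.) -/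
def HasListedType (W : Subgroup (V ≃ₗᵢ[ℝ] V)) : Prop :=
  HasType W (CoxeterMatrix.A 1) ∨
  (∃ n : ℕ, HasType W (CoxeterMatrix.B n)) ∨
  (∃ n : ℕ, HasType W (typeD (2 * n))) ∨
  HasType W CoxeterMatrix.E₇ ∨
  HasType W CoxeterMatrix.E₈ ∨
  HasType W CoxeterMatrix.F₄ ∨
  (∃ n : ℕ, HasType W (CoxeterMatrix.I (2 * n))) ∨
  HasType W CoxeterMatrix.H₃ ∨
  HasType W CoxeterMatrix.H₄

/-! ### Faces -/

/-- A fixed normal vector of a hyperplane of the arrangement; it labels the two half spaces. -/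
def normal {W : Subgroup (V ≃ₗᵢ[ℝ] V)} (H : arrangement W) : V := H.2.1.choose

lemma normal_ne_zero {W : Subgroup (V ≃ₗᵢ[ℝ] V)} (H : arrangement W) : normal H ≠ 0 :=
  H.2.1.choose_spec.1

lemma eq_normal_orthogonal {W : Subgroup (V ≃ₗᵢ[ℝ] V)} (H : arrangement W) :
    (H : Submodule ℝ V) = (ℝ ∙ normal H)ᗮ :=
  H.2.1.choose_spec.2

/-- The side of `H` on which `v` lies. -/
def side {W : Subgroup (V ≃ₗᵢ[ℝ] V)} (H : arrangement W) (v : V) : SignType :=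
  SignType.sign (inner ℝ (normal H) v : ℝ)

lemma side_eq_zero {W : Subgroup (V ≃ₗᵢ[ℝ] V)} (H : arrangement W) (v : V) :
    side H v = 0 ↔ v ∈ (H : Submodule ℝ V) := by
  rw [eq_normal_orthogonal, Submodule.mem_orthogonal_singleton_iff_inner_right, side,
    sign_eq_zero_iff]

/-- The sets `H⁺`, `H⁻` and `H⁰ = H`. -/
def halfSpace {W : Subgroup (V ≃ₗᵢ[ℝ] V)} (H : arrangement W) (s : SignType) : Set V :=
  {v | side H v = s}

/-- The intersection of the `H^{σ_H}` over the arrangement. -/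
def cell {W : Subgroup (V ≃ₗᵢ[ℝ] V)} (σ : arrangement W → SignType) : Set V :=
  ⋂ H, halfSpace H (σ H)

lemma mem_cell {W : Subgroup (V ≃ₗᵢ[ℝ] V)} {σ : arrangement W → SignType} {v : V} :
    v ∈ cell σ ↔ ∀ H, side H v = σ H := by
  simp [cell, halfSpace]

/-- The faces of the arrangement: the non-empty intersections of the form `⋂ H^{σ_H}`. -/
@[ext]
structure Face (W : Subgroup (V ≃ₗᵢ[ℝ] V)) where
  carrier : Set V
  nonempty : carrier.Nonempty
  exists_sign : ∃ σ : arrangement W → SignType, carrier = cell σ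

namespace Face

variable {W : Subgroup (V ≃ₗᵢ[ℝ] V)}

/-- The sign sequence of a face. -/
def sign (x : Face W) : arrangement W → SignType := x.exists_sign.choose

lemma carrier_eq (x : Face W) : x.carrier = cell x.sign := x.exists_sign.choose_spec

lemma mem_iff (x : Face W) {v : V} : v ∈ x.carrier ↔ ∀ H, side H v = x.sign H := by
  rw [carrier_eq, mem_cell]

lemma eq_of_sign {x y : Face W} (h : x.sign = y.sign) : x = y := by
  ext1
  rw [carrier_eq, carrier_eq, h]

lemma eq_of_mem {x y : Face W} {v : V} (hx : v ∈ x.carrier) (hy : v ∈ y.carrier) : x = y :=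
  eq_of_sign <| funext fun H ↦ by rw [← x.mem_iff.1 hx H, y.mem_iff.1 hy H]

/-- The face that contains a given vector. -/
def of (W : Subgroup (V ≃ₗᵢ[ℝ] V)) (v : V) : Face W where
  carrier := cell fun H ↦ side H v
  nonempty := ⟨v, mem_cell.2 fun _ ↦ rfl⟩
  exists_sign := ⟨_, rfl⟩

lemma mem_of (v : V) : v ∈ (of W v).carrier := mem_cell.2 fun _ ↦ rfl

lemma sign_of (v : V) (H : arrangement W) : (of W v).sign H = side H v :=
  ((of W v).mem_iff.1 (mem_of v) H).symm

lemma eq_of_of_mem {x : Face W} {v : V} (hx : v ∈ x.carrier) : x = of W v :=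
  eq_of_mem hx (mem_of v)

end Face

/-- The sign sequence of the product of two faces. -/
def mulSign {ι : Type*} (σ τ : ι → SignType) : ι → SignType :=
  fun H ↦ if σ H ≠ 0 then σ H else τ H

section Finiteness

lemma reflection_injective {H K : Submodule ℝ V} (h : H.reflection = K.reflection) : H = K := by
  ext v
  rw [← Submodule.reflection_eq_self_iff, ← Submodule.reflection_eq_self_iff, h]

instance arrangement_finite (W : Subgroup (V ≃ₗᵢ[ℝ] V)) [Finite W] : Finite (arrangement W) :=
  Finite.of_injective (fun H ↦ (⟨(H : Submodule ℝ V).reflection, H.2.2⟩ : W)) fun _ _ h ↦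
    Subtype.ext (reflection_injective (congrArg Subtype.val h))

variable {W : Subgroup (V ≃ₗᵢ[ℝ] V)} [Finite W]

instance face_finite : Finite (Face W) :=
  Finite.of_injective Face.sign fun _ _ ↦ Face.eq_of_sign

lemma eventually_side (v u : V) : ∀ᶠ t : ℝ in nhdsWithin 0 (Set.Ioi 0), ∀ H : arrangement W,
    side H (v + t • u) = mulSign (fun H ↦ side H v) (fun H ↦ side H u) H := by
  rw [Filter.eventually_all]
  intro H
  have hc : Filter.Tendsto (fun t : ℝ ↦ (inner ℝ (normal H) (v + t • u) : ℝ))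
      (nhdsWithin 0 (Set.Ioi 0)) (nhds (inner ℝ (normal H) v)) := by
    have : Continuous fun t : ℝ ↦ (inner ℝ (normal H) (v + t • u) : ℝ) := by fun_prop
    simpa using (this.tendsto 0).mono_left nhdsWithin_le_nhds
  simp only [mulSign, side]
  rcases lt_trichotomy (inner ℝ (normal H) v : ℝ) 0 with h | h | h
  · filter_upwards [hc.eventually (gt_mem_nhds h)] with t ht
    simp [sign_neg ht, sign_neg h]
  · filter_upwards [self_mem_nhdsWithin] with t ht
    have ht : (0 : ℝ) < t := ht
    simp [inner_add_right, inner_smul_right, h, sign_mul, sign_pos ht]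
  · filter_upwards [hc.eventually (lt_mem_nhds h)] with t ht
    simp [sign_pos ht, sign_pos h]

lemma cell_mulSign_nonempty (x y : Face W) : (cell (mulSign x.sign y.sign)).Nonempty := by
  obtain ⟨v, hv⟩ := x.nonempty
  obtain ⟨u, hu⟩ := y.nonempty
  obtain ⟨t, ht⟩ := (eventually_side (W := W) v u).exists
  refine ⟨v + t • u, mem_cell.2 fun H ↦ ?_⟩
  rw [ht H, mulSign, mulSign, x.mem_iff.1 hv H, y.mem_iff.1 hu H]

/-- The product `xy` of two faces. -/
instance : Mul (Face W) where
  mul x y := ⟨cell (mulSign x.sign y.sign), cell_mulSign_nonempty x y, _, rfl⟩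

/-- The identity: the intersection of all the hyperplanes. -/
instance : One (Face W) where
  one := ⟨cell fun _ ↦ 0, ⟨0, mem_cell.2 fun H ↦ by simp [side]⟩, _, rfl⟩

lemma Face.sign_mul (x y : Face W) : (x * y).sign = mulSign x.sign y.sign := by
  obtain ⟨v, hv⟩ := cell_mulSign_nonempty x y
  funext H
  rw [← mem_cell.1 hv H, (x * y).mem_iff.1 hv H]

lemma Face.sign_one : (1 : Face W).sign = fun _ ↦ 0 := by
  have h : (0 : V) ∈ (1 : Face W).carrier := mem_cell.2 fun H ↦ by simp [side]
  funext H
  rw [← (1 : Face W).mem_iff.1 h H]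
  simp [side]

/-- The face semigroup. -/
instance : Monoid (Face W) where
  mul_assoc x y z := Face.eq_of_sign <| by
    simp only [Face.sign_mul]
    funext H
    simp only [mulSign]
    split_ifs <;> simp_all
  one_mul x := Face.eq_of_sign <| by
    simp only [Face.sign_mul, Face.sign_one]
    funext H
    simp [mulSign]
  mul_one x := Face.eq_of_sign <| by
    simp only [Face.sign_mul, Face.sign_one]
    funext H
    simp only [mulSign]
    split_ifs <;> simp_all

lemma Face.eventually_mem_mul {x y : Face W} {v u : V} (hv : v ∈ x.carrier) (hu : u ∈ y.carrier) :
    ∀ᶠ t : ℝ in nhdsWithin 0 (Set.Ioi 0), v + t • u ∈ (x * y).carrier := by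
  filter_upwards [eventually_side (W := W) v u] with t ht
  refine (x * y).mem_iff.2 fun H ↦ ?_
  rw [ht H, Face.sign_mul, mulSign, mulSign, x.mem_iff.1 hv H, y.mem_iff.1 hu H]

end Finiteness

/-! ### Support and the intersection lattice -/

variable {W : Subgroup (V ≃ₗᵢ[ℝ] V)}

/-- The support of a face: the intersection of all hyperplanes that contain it. -/
def supp (x : Face W) : Submodule ℝ V :=
  sInf {H | H ∈ arrangement W ∧ x.carrier ⊆ H}

/-- The intersection lattice: the supports of the faces, ordered by inclusion. -/
def Flat (W : Subgroup (V ≃ₗᵢ[ℝ] V)) : Type _ := {X : Submodule ℝ V // ∃ x : Face W, supp x = X}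

instance : PartialOrder (Flat W) := Subtype.partialOrder _

/-- The support of a face as an element of the intersection lattice. -/
def Face.flat (x : Face W) : Flat W := ⟨supp x, x, rfl⟩

instance [Finite W] : Finite (Flat W) :=
  Finite.of_surjective Face.flat fun X ↦ ⟨X.2.choose, Subtype.ext X.2.choose_spec⟩

/-! ### The action of `W` -/

/-- The image of a subspace under an isometry. -/
def mapSub (w : V ≃ₗᵢ[ℝ] V) (X : Submodule ℝ V) : Submodule ℝ V :=
  X.map (w.toLinearEquiv : V →ₗ[ℝ] V)

lemma mem_mapSub {w : V ≃ₗᵢ[ℝ] V} {X : Submodule ℝ V} {v : V} : v ∈ mapSub w X ↔ w⁻¹ v ∈ X := by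
  constructor
  · rintro ⟨u, hu, rfl⟩
    have : w⁻¹ (w u) = u := w.symm_apply_apply u
    simpa [this] using hu
  · intro h
    exact ⟨w⁻¹ v, h, w.apply_symm_apply v⟩

lemma mapSub_hyperplane (w : V ≃ₗᵢ[ℝ] V) (u : V) : mapSub w (ℝ ∙ u)ᗮ = (ℝ ∙ w u)ᗮ := by
  ext v
  rw [mem_mapSub, Submodule.mem_orthogonal_singleton_iff_inner_right,
    Submodule.mem_orthogonal_singleton_iff_inner_right, ← w.inner_map_map u]
  have : w (w⁻¹ v) = v := w.apply_symm_apply v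
  rw [this]

lemma mapSub_mem_arrangement {w : V ≃ₗᵢ[ℝ] V} (hw : w ∈ W) {H : Submodule ℝ V}
    (hH : H ∈ arrangement W) : mapSub w H ∈ arrangement W := by
  obtain ⟨⟨u, hu, rfl⟩, hr⟩ := hH
  refine ⟨⟨w u, by simpa using hu, mapSub_hyperplane w u⟩, ?_⟩
  have h : (mapSub w (ℝ ∙ u)ᗮ).reflection = w * (ℝ ∙ u)ᗮ.reflection * w⁻¹ :=
    Submodule.reflection_map w (ℝ ∙ u)ᗮ
  rw [h]
  exact W.mul_mem (W.mul_mem hw hr) (W.inv_mem hw)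

lemma side_map {w : V ≃ₗᵢ[ℝ] V} (hw : w ∈ W) {v v' : V}
    (h : ∀ H : arrangement W, side H v = side H v') (H : arrangement W) :
    side H (w v) = side H (w v') := by
  have hin : ∀ z : V, (inner ℝ (normal H) (w z) : ℝ) = inner ℝ (w⁻¹ (normal H)) z := fun z ↦ by
    rw [← w.inner_map_map (w⁻¹ (normal H)) z]
    have : w (w⁻¹ (normal H)) = normal H := w.apply_symm_apply _
    rw [this]
  let K : arrangement W := ⟨mapSub w⁻¹ H, mapSub_mem_arrangement (W.inv_mem hw) H.2⟩
  have hK : (ℝ ∙ normal K)ᗮ = (ℝ ∙ w⁻¹ (normal H))ᗮ := by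
    rw [← eq_normal_orthogonal K, ← mapSub_hyperplane, ← eq_normal_orthogonal H]
  have hK' : (ℝ ∙ normal K) = (ℝ ∙ w⁻¹ (normal H)) := by
    rw [← Submodule.orthogonal_orthogonal (ℝ ∙ normal K), hK, Submodule.orthogonal_orthogonal]
  have hmem : w⁻¹ (normal H) ∈ (ℝ ∙ normal K) := hK' ▸ Submodule.mem_span_singleton_self _
  obtain ⟨c, hc⟩ := Submodule.mem_span_singleton.1 hmem
  have hs := h K
  simp only [side] at hs ⊢
  rw [hin, hin, ← hc, real_inner_smul_left, real_inner_smul_left, _root_.sign_mul,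
    _root_.sign_mul, hs]

lemma image_face {w : V ≃ₗᵢ[ℝ] V} (hw : w ∈ W) {x : Face W} {v : V} (hv : v ∈ x.carrier) :
    w '' x.carrier = cell (W := W) fun H ↦ side H (w v) := by
  ext z
  rw [mem_cell]
  constructor
  · rintro ⟨u, hu, rfl⟩ H
    exact side_map hw (fun K ↦ by rw [x.mem_iff.1 hu K, x.mem_iff.1 hv K]) H
  · intro hz
    have hzz : w (w⁻¹ z) = z := w.apply_symm_apply z
    have hvv : w⁻¹ (w v) = v := w.symm_apply_apply v
    refine ⟨w⁻¹ z, x.mem_iff.2 fun K ↦ ?_, hzz⟩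
    rw [side_map (W.inv_mem hw) hz K, hvv, x.mem_iff.1 hv K]

/-- `W` acts on the faces by taking images. -/
instance : SMul W (Face W) where
  smul w x := ⟨(w : V ≃ₗᵢ[ℝ] V) '' x.carrier, x.nonempty.image _, _,
    image_face w.2 x.nonempty.choose_spec⟩

lemma Face.smul_carrier (w : W) (x : Face W) :
    (w • x).carrier = (w : V ≃ₗᵢ[ℝ] V) '' x.carrier := rfl

instance : MulAction W (Face W) where
  one_smul x := by
    ext1
    simp [Face.smul_carrier]
  mul_smul w w' x := by
    ext1
    simp [Face.smul_carrier, Set.image_image]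

/-- The action on the faces preserves the product. -/
instance [Finite W] : MulDistribMulAction W (Face W) where
  smul_one w := by
    refine Face.eq_of_mem (v := (0 : V)) ?_ (mem_cell.2 fun H ↦ by simp [side])
    exact ⟨0, mem_cell.2 fun H ↦ by simp [side], by simp⟩
  smul_mul w x y := by
    obtain ⟨v, hv⟩ := x.nonempty
    obtain ⟨u, hu⟩ := y.nonempty
    have hv' : (w : V ≃ₗᵢ[ℝ] V) v ∈ (w • x).carrier := ⟨v, hv, rfl⟩
    have hu' : (w : V ≃ₗᵢ[ℝ] V) u ∈ (w • y).carrier := ⟨u, hu, rfl⟩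
    obtain ⟨t, h1, h2⟩ :=
      ((Face.eventually_mem_mul hv hu).and (Face.eventually_mem_mul hv' hu')).exists
    exact Face.eq_of_mem ⟨_, h1, by simp⟩ h2

lemma supp_smul (w : W) (x : Face W) : supp (w • x) = mapSub (w : V ≃ₗᵢ[ℝ] V) (supp x) := by
  have key : ∀ (w : W) (x : Face W) (v : V), v ∈ supp x →
      (w : V ≃ₗᵢ[ℝ] V) v ∈ supp (w • x) := by
    intro w x v hv
    refine Submodule.mem_sInf.2 fun H hH ↦ ?_
    have h1 : mapSub (w⁻¹ : W) H ∈ arrangement W := mapSub_mem_arrangement (w⁻¹ : W).2 hH.1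
    have h2 := Submodule.mem_sInf.1 hv _ ⟨h1, fun u hu ↦ ?_⟩
    · rw [mem_mapSub] at h2
      simpa using h2
    · have h3 := hH.2 ⟨u, hu, rfl⟩
      rw [SetLike.mem_coe, mem_mapSub]
      simpa using h3
  ext v
  rw [mem_mapSub]
  constructor
  · intro h
    simpa using key w⁻¹ _ _ h
  · intro h
    have hh := key w _ _ h
    have hvv : (w : V ≃ₗᵢ[ℝ] V) ((w : V ≃ₗᵢ[ℝ] V)⁻¹ v) = v :=
      (w : V ≃ₗᵢ[ℝ] V).apply_symm_apply v
    rwa [hvv] at hh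

/-- `W` acts on the intersection lattice by taking images. -/
instance : SMul W (Flat W) where
  smul w X := ⟨mapSub (w : V ≃ₗᵢ[ℝ] V) X.1, by
    obtain ⟨x, hx⟩ := X.2
    exact ⟨w • x, by rw [supp_smul, hx]⟩⟩

lemma Flat.smul_val (w : W) (X : Flat W) : (w • X).1 = mapSub (w : V ≃ₗᵢ[ℝ] V) X.1 := rfl

lemma Face.flat_smul (w : W) (x : Face W) : (w • x).flat = w • x.flat :=
  Subtype.ext (supp_smul w x)

instance : MulAction W (Flat W) where
  one_smul X := Subtype.ext <| by
    ext v
    rw [Flat.smul_val, mem_mapSub]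
    simp
  mul_smul w w' X := Subtype.ext <| by
    ext v
    simp only [Flat.smul_val, mem_mapSub]
    simp

lemma Flat.smul_le_smul (w : W) {X Y : Flat W} (h : X ≤ Y) : w • X ≤ w • Y :=
  Submodule.map_mono (show X.1 ≤ Y.1 from h)

lemma Flat.smul_lt_smul_iff (w : W) {X Y : Flat W} : w • X < w • Y ↔ X < Y := by
  have h : ∀ (w : W) {X Y : Flat W}, X < Y → w • X < w • Y := fun w X Y h ↦
    lt_of_le_of_ne (Flat.smul_le_smul w h.le) fun he ↦ h.ne (MulAction.injective w he)
  exact ⟨fun hh ↦ by simpa using h w⁻¹ hh, h w⟩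

/-- The rank of `X` in the intersection lattice: `dim X - dim (⋂ H)`. The subtraction is not
truncated, since every `X` contains the intersection of all hyperplanes. -/
def Flat.rank (X : Flat W) : ℕ :=
  Module.finrank ℝ X.1 - Module.finrank ℝ (sInf (arrangement W) : Submodule ℝ V)

lemma Flat.finrank_smul (w : W) (X : Flat W) :
    Module.finrank ℝ (w • X).1 = Module.finrank ℝ X.1 :=
  LinearEquiv.finrank_map_eq (w : V ≃ₗᵢ[ℝ] V).toLinearEquiv X.1

/-- The set of `W`-orbits on the intersection lattice. -/
def Orbit (W : Subgroup (V ≃ₗᵢ[ℝ] V)) : Type _ := Quotient (MulAction.orbitRel W (Flat W))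

/-- The orbit of an element of the intersection lattice. -/
def Flat.orbit (X : Flat W) : Orbit W := Quotient.mk _ X

lemma Flat.orbit_eq_iff {X Y : Flat W} : X.orbit = Y.orbit ↔ ∃ w : W, w • Y = X :=
  Quotient.eq.trans (MulAction.orbitRel_apply.trans MulAction.mem_orbit_iff)

lemma Flat.orbit_smul (w : W) (X : Flat W) : (w • X).orbit = X.orbit :=
  Flat.orbit_eq_iff.2 ⟨w, rfl⟩

/-- The partial order on the orbits: `𝒪_X ≤ 𝒪_Y` if and only if `w(X) ≤ Y` for some `w`. -/
instance : PartialOrder (Orbit W) where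
  le P Q := ∃ X Y : Flat W, X.orbit = P ∧ Y.orbit = Q ∧ X ≤ Y
  le_refl P := by
    obtain ⟨X, rfl⟩ := Quotient.exists_rep P
    exact ⟨X, X, rfl, rfl, le_rfl⟩
  le_trans P Q R := by
    rintro ⟨X, Y, rfl, rfl, h⟩ ⟨Y', Z, hY, rfl, h'⟩
    obtain ⟨w, rfl⟩ := Flat.orbit_eq_iff.1 hY
    exact ⟨w • X, Z, Flat.orbit_smul w X, rfl, (Flat.smul_le_smul w h).trans h'⟩
  le_antisymm P Q := by
    rintro ⟨X, Y, rfl, rfl, h⟩ ⟨Y', X', hY, hX, h'⟩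
    obtain ⟨w, rfl⟩ := Flat.orbit_eq_iff.1 hY
    obtain ⟨w', rfl⟩ := Flat.orbit_eq_iff.1 hX
    have h2 : Module.finrank ℝ Y.1 ≤ Module.finrank ℝ X.1 := by
      have := Submodule.finrank_mono (show (w • Y).1 ≤ (w' • X).1 from h')
      rwa [Flat.finrank_smul, Flat.finrank_smul] at this
    exact congrArg Flat.orbit
      (Subtype.ext (Submodule.eq_of_le_of_finrank_le (show X.1 ≤ Y.1 from h) h2))

lemma Orbit.orbit_le_iff {X Y : Flat W} : X.orbit ≤ Y.orbit ↔ ∃ w : W, w • X ≤ Y := by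
  constructor
  · rintro ⟨X', Y', hX, hY, h⟩
    obtain ⟨w, rfl⟩ := Flat.orbit_eq_iff.1 hX
    obtain ⟨w', rfl⟩ := Flat.orbit_eq_iff.1 hY
    refine ⟨w'⁻¹ * w, ?_⟩
    simpa [mul_smul] using Flat.smul_le_smul w'⁻¹ h
  · rintro ⟨w, h⟩
    exact ⟨w • X, Y, Flat.orbit_smul w X, rfl, h⟩

/-- The rank of an orbit: the rank of any of its elements. -/
def Orbit.rank (P : Orbit W) : ℕ :=
  Quotient.lift (s := MulAction.orbitRel W (Flat W)) Flat.rank (fun X Y h ↦ by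
    obtain ⟨w, rfl⟩ := MulAction.mem_orbit_iff.1 (MulAction.orbitRel_apply.1 h)
    rw [Flat.rank, Flat.rank, Flat.finrank_smul]) P

lemma Orbit.rank_orbit (X : Flat W) : X.orbit.rank = X.rank := rfl

/-! ### The face semigroup algebra and its invariants -/

variable {k : Type*} [Field k] [Finite W]

/-- The action of `w` on the face semigroup algebra, extended linearly from the faces. -/
def act (k : Type*) [Field k] (w : W) : MonoidAlgebra k (Face W) →ₐ[k] MonoidAlgebra k (Face W) :=
  MonoidAlgebra.mapDomainAlgHom k k (MulDistribMulAction.toMonoidHom (Face W) w)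

/-- The `W`-invariant subalgebra of the face semigroup algebra. -/
def invariants (k : Type*) [Field k] (W : Subgroup (V ≃ₗᵢ[ℝ] V)) [Finite W] :
    Subalgebra k (MonoidAlgebra k (Face W)) :=
  ⨅ w : W, AlgHom.equalizer (act k w) (AlgHom.id k _)

lemma mem_invariants {a : MonoidAlgebra k (Face W)} :
    a ∈ invariants k W ↔ ∀ w : W, act k w a = a := by
  simp [invariants, Algebra.mem_iInf]

/-- A family `ℓ_X`, for `X` in the intersection lattice, of linear combinations of faces of
support `X` with coefficients summing to `1`, such that `w(ℓ_X) = ℓ_{w(X)}`. -/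
structure EllFamily (k : Type*) [Field k] (W : Subgroup (V ≃ₗᵢ[ℝ] V)) [Finite W] where
  ell : Flat W → MonoidAlgebra k (Face W)
  supp_eq : ∀ (X : Flat W) (x : Face W), (ell X).coeff x ≠ 0 → x.flat = X
  sum_eq_one : ∀ X : Flat W, ((ell X).coeff.sum fun _ a ↦ a) = 1
  act_ell : ∀ (w : W) (X : Flat W), act k w (ell X) = ell (w • X)

namespace EllFamily

open Classical in
/-- The elements `e_X = ℓ_X - ∑_{Y > X} ℓ_X e_Y`. -/
def idem (ℓ : EllFamily k W) (X : Flat W) : MonoidAlgebra k (Face W) :=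
  letI := Fintype.ofFinite (Flat W)
  ℓ.ell X - ∑ Y : {Y : Flat W // X < Y}, ℓ.ell X * ℓ.idem Y.1
termination_by (wellFounded_gt (α := Flat W)).wrap X
decreasing_by exact Y.2

open Classical in
lemma idem_eq (ℓ : EllFamily k W) (X : Flat W) [Fintype (Flat W)] :
    ℓ.idem X = ℓ.ell X - ∑ Y : {Y : Flat W // X < Y}, ℓ.ell X * ℓ.idem Y.1 := by
  rw [idem]
  congr!

lemma act_idem (ℓ : EllFamily k W) (w : W) (X : Flat W) :
    act k w (ℓ.idem X) = ℓ.idem (w • X) := by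
  classical
  let _ := Fintype.ofFinite (Flat W)
  induction X using (wellFounded_gt (α := Flat W)).induction with
  | _ X ih =>
    rw [idem_eq, idem_eq, map_sub, map_sum, ℓ.act_ell]
    congr 1
    refine Fintype.sum_equiv
      ((MulAction.toPerm w).subtypeEquiv fun Y ↦ (Flat.smul_lt_smul_iff w).symm) _ _ fun Y ↦ ?_
    rw [map_mul, ℓ.act_ell, ih Y.1 Y.2]
    rfl

open Classical in
/-- The element `ε_𝒪 = ∑_{X ∈ 𝒪} e_X` of the invariant subalgebra. -/
def orbitIdem (ℓ : EllFamily k W) (P : Orbit W) : invariants k W :=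
  letI := Fintype.ofFinite (Flat W)
  ⟨∑ X : {X : Flat W // X.orbit = P}, ℓ.idem X.1, mem_invariants.2 fun w ↦ by
    rw [map_sum]
    refine Fintype.sum_equiv
      ((MulAction.toPerm w).subtypeEquiv fun X ↦ ?_) _ _ fun X ↦ ℓ.act_idem w X.1
    rw [MulAction.toPerm_apply, Flat.orbit_smul]⟩

end EllFamily

/-! ### The quiver -/

/-- For a finite dimensional split basic `k`-algebra `A` and members `e`, `f` of a complete system
of primitive orthogonal idempotents, the number `dim_k f (rad A / rad² A) e` of arrows from the
vertex of `e` to the vertex of `f` in the quiver of `A`. Here `f (rad A / rad² A) e` is formed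
inside `A / rad² A`. -/
def numArrows (k : Type*) [Field k] {A : Type*} [Ring A] [Algebra k A] (e f : A) : Cardinal :=
  Module.rank k
    (((Submodule.restrictScalars k (Ring.jacobson A)).map
      (LinearMap.mulLeft k f ∘ₗ LinearMap.mulRight k e)).map
        (Submodule.restrictScalars k (Ring.jacobson A * Ring.jacobson A : Ideal A)).mkQ)

/-- The number of arrows from `P` to `Q` in the quiver of the invariant subalgebra, whose vertices
are the `W`-orbits on the intersection lattice, the orbit `𝒪` corresponding to `ε_𝒪`. -/
def EllFamily.arrows (ℓ : EllFamily k W) (P Q : Orbit W) : Cardinal :=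
  numArrows k (ℓ.orbitIdem P) (ℓ.orbitIdem Q)

end FaceQuiver

end

/-!
The reflection `z` in the intersection `⋂ H` of all hyperplanes, that is, the map which is the
identity on `⋂ H` and `-1` on its orthogonal complement, is the key to the result.

For each of the listed types, `z` belongs to `W`. Let `r` be the number of walls of a chamber. Their
normal vectors span the orthogonal complement of `⋂ H` (`FaceQuiver.mem_of_forall_wall`), so if `W`
contains reflections in `r` pairwise orthogonal vectors, then `z` is their product
(`FaceQuiver.reflection_center_mem`). Such orthogonal roots are found from simple roots. The orders
of the products `s t` determine the angles between the walls up to sign (and, for order five, up to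
an algebraic conjugation that does no harm); the Coxeter diagram is a forest, so one can choose the
signs of the normal vectors such that the Gram matrix is the usual one
(`FaceQuiver.exists_roots_of_gram`). There is then an explicit set of orthogonal roots in each type.

The element `z` maps every face to the opposite face. It acts on `e_X kℱ e_Y` as multiplication by
`(-1) ^ (dim Y - dim X)` (`FaceQuiver.EllFamily.act_antipode`). To see this, let `b` be in
`e_X kℱ e_Y`. It is annihilated from the left by all faces whose support is not contained in `X`,
and it is determined by its coefficients at the faces of support `Y`. Consider the sum of these
coefficients over the faces with prescribed signs on a set `J` of hyperplanes between `X` and `Y`.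
If `⋂ J` meets `Y` in more than `X`, a face in this intersection annihilates `b` without changing
the sum, so the sum vanishes. Leaving out one condition adds the sums for its two signs. Hence, if
`J` is an independent set with `Y ∩ ⋂ J = X`, each change of a sign negates the sum, and reversing
all the signs gives the factor `(-1) ^ (dim Y - dim X)`. For dependent sets, induction applies,
because a linear relation provides a choice of signs which no face has (`signSum_neg`). Since
`e_X = ℓ_X e_X`, the coefficients of `b` are combinations of such sums for the set of all
hyperplanes between `X` and `Y`.

If the ranks of `𝒪` and `𝒪'` differ by an odd number, it follows that `z` negates the elements of
`ε_𝒪 A ε_𝒪'`. But they are also invariant, and the characteristic of `k` is not two because `z` has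
order two. So `ε_𝒪 A ε_𝒪' = 0`, which leaves no room for arrows. Finally, the ranks of `𝒪` and `𝒪'`
differ by one if `𝒪'` covers `𝒪`, because `ℒ` is graded by dimension
(`FaceQuiver.Orbit.rank_of_covBy`).
-/

set_option linter.unusedSectionVars false

noncomputable section

/-! ### Sums over sign conditions -/

section SignSums

variable {ι D k U : Type*} [Fintype D] [CommRing k] [AddCommGroup U] [Module ℝ U]

open Classical in
/-- The sum of `b` over the elements whose signs on `J` are prescribed by `ε`. -/
def signSum (s : D → ι → SignType) (b : D → k) (J : Finset ι) (ε : ι → SignType) : k :=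
  ∑ x with ∀ h ∈ J, s x h = ε h, b x

variable {s : D → ι → SignType} {b : D → k} {J : Finset ι} {ε ε' : ι → SignType}

lemma signSum_congr (h : ∀ i ∈ J, ε i = ε' i) : signSum s b J ε = signSum s b J ε' := by
  classical
  unfold signSum
  congr 1
  ext x
  simp only [Finset.mem_filter, Finset.mem_univ, true_and]
  exact forall₂_congr fun i hi ↦ by rw [h i hi]

lemma signSum_eq_zero (h : ∀ x, ¬ ∀ i ∈ J, s x i = ε i) : signSum s b J ε = 0 := by
  classical
  unfold signSum
  rw [Finset.filter_eq_empty_iff.2 fun x _ ↦ h x, Finset.sum_empty]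

lemma SignType.eq_or_eq_neg_of_ne_zero {a b : SignType} (ha : a ≠ 0) (hb : b ≠ 0) :
    a = b ∨ a = -b := by
  revert a b; decide

lemma SignType.ne_neg_self {a : SignType} (ha : a ≠ 0) : a ≠ -a := by
  revert a; decide

/-- Forgetting one of the conditions adds the sums for its two signs. -/
lemma signSum_erase [DecidableEq ι] {i : ι} (hi : i ∈ J) (hs : ∀ x, s x i ≠ 0) (hε : ε i ≠ 0) :
    signSum s b J ε + signSum s b J (Function.update ε i (-ε i)) = signSum s b (J.erase i) ε := by
  classical
  unfold signSum
  rw [← Finset.sum_union]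
  · congr 1
    ext x
    simp only [Finset.mem_filter, Finset.mem_univ, true_and, Finset.mem_union, Finset.mem_erase]
    constructor
    · rintro (h | h) j ⟨hj, hjJ⟩
      · exact h j hjJ
      · rw [h j hjJ, Function.update_of_ne hj]
    · intro h
      refine (SignType.eq_or_eq_neg_of_ne_zero (hs x) hε).imp (fun hx j hj ↦ ?_) fun hx j hj ↦ ?_
      · by_cases hji : j = i
        · rw [hji, hx]
        · exact h j ⟨hji, hj⟩
      · by_cases hji : j = i
        · rw [hji, Function.update_self, hx]
        · rw [Function.update_of_ne hji, h j ⟨hji, hj⟩]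
  · rw [Finset.disjoint_filter]
    intro x _ h h'
    have h1 := h i hi
    have h2 := h' i hi
    rw [Function.update_self, h1] at h2
    exact SignType.ne_neg_self hε h2

/-- If a quantity depending on signs is negated by each single change of sign, then it picks up
the expected sign under several changes. -/
lemma apply_piecewise_neg [DecidableEq ι] {f : (ι → SignType) → k}
    (hf : ∀ i ∈ J, ∀ ε : ι → SignType, (∀ j ∈ J, ε j ≠ 0) →
      f (Function.update ε i (-ε i)) = - f ε) (hε : ∀ j ∈ J, ε j ≠ 0)
    {T : Finset ι} (hT : T ⊆ J) : f (T.piecewise (-ε) ε) = (-1) ^ T.card * f ε := by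
  induction T using Finset.induction_on with
  | empty => simp
  | insert i T hi ih =>
    have hiJ := hT (Finset.mem_insert_self i T)
    have hT' := (Finset.subset_insert i T).trans hT
    have h1 : (insert i T).piecewise (-ε) ε =
        Function.update (T.piecewise (-ε) ε) i (-(T.piecewise (-ε) ε) i) := by
      rw [Finset.piecewise_insert, Finset.piecewise_eq_of_notMem _ _ _ hi, Pi.neg_apply]
    rw [h1, hf i hiJ, ih hT', Finset.card_insert_of_notMem hi, pow_succ]
    · ring
    · intro j hj
      by_cases hjT : j ∈ T
      · rw [Finset.piecewise_eq_of_mem _ _ _ hjT, Pi.neg_apply]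
        simpa using hε j hj
      · rw [Finset.piecewise_eq_of_notMem _ _ _ hjT]
        exact hε j hj

/-- Suppose that the signs come from linear functionals. If the sums over linearly independent
sets of conditions either vanish, or involve `d` conditions and vanish when one is left out, then
reversing all the signs multiplies every sum by `(-1) ^ d`. The proof is by induction on the
number of conditions: modulo smaller sets, the defect changes its sign when one condition is
reversed, and for linearly dependent functionals some choice of signs is not attained. -/
theorem signSum_neg (n : ι → U →ₗ[ℝ] ℝ) (p : D → U) (d : ℕ) (J₀ : Finset ι)
    (hp : ∀ x, ∀ i ∈ J₀, n i (p x) ≠ 0) (b : D → k)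
    (hJ : ∀ J ⊆ J₀, LinearIndependent ℝ (fun i : J ↦ n i) →
      (∀ ε, signSum (fun x i ↦ SignType.sign (n i (p x))) b J ε = 0) ∨
      J.card = d ∧ ∀ i ∈ J, ∀ J' : Finset ι, J' ⊆ J → i ∉ J' →
        ∀ ε, signSum (fun x i ↦ SignType.sign (n i (p x))) b J' ε = 0)
    (J : Finset ι) (hJJ : J ⊆ J₀) (ε : ι → SignType) (hε : ∀ i ∈ J, ε i ≠ 0) :
    signSum (fun x i ↦ SignType.sign (n i (p x))) b J ε =
      (-1) ^ d * signSum (fun x i ↦ SignType.sign (n i (p x))) b J (-ε) := by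
  classical
  set g : Finset ι → (ι → SignType) → k :=
    signSum (fun x i ↦ SignType.sign (n i (p x))) b with hg
  have hflip : ∀ J ⊆ J₀, ∀ i ∈ J, ∀ ε : ι → SignType, (∀ j ∈ J, ε j ≠ 0) →
      g J ε + g J (Function.update ε i (-ε i)) = g (J.erase i) ε := fun J hJJ i hi ε hε ↦
    signSum_erase hi (fun x ↦ by simpa using hp x i (hJJ hi)) (hε i hi)
  have hfull : ∀ (J : Finset ι) (ε : ι → SignType), g J (J.piecewise (-ε) ε) = g J (-ε) :=
    fun J ε ↦ signSum_congr fun i hi ↦ Finset.piecewise_eq_of_mem _ _ _ hi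
  induction J using Finset.strongInduction generalizing ε with
  | H J ih =>
  by_cases hli : LinearIndependent ℝ (fun i : J ↦ n i)
  · rcases hJ J hJJ hli with h0 | ⟨hcard, h0⟩
    · rw [h0, h0, mul_zero]
    · have hneg := apply_piecewise_neg (f := g J) (J := J) (fun i hi ε hε ↦ by
        have h := hflip J hJJ i hi ε hε
        rw [h0 i hi _ (Finset.erase_subset i J) (Finset.notMem_erase i J) ε] at h
        exact (neg_eq_of_add_eq_zero_right h).symm) hε subset_rfl
      rw [hfull, hcard] at hneg
      rw [hneg, ← mul_assoc, ← mul_pow]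
      simp
  · -- a linear relation provides signs that no vector has
    set δ : (ι → SignType) → k := fun ε ↦ g J ε - (-1) ^ d * g J (-ε) with hδ
    have hδneg : ∀ i ∈ J, ∀ ε : ι → SignType, (∀ j ∈ J, ε j ≠ 0) →
        δ (Function.update ε i (-ε i)) = - δ ε := by
      intro i hi ε hε
      have h1 := hflip J hJJ i hi ε hε
      have h2 := hflip J hJJ i hi (-ε) (fun j hj ↦ by simpa using hε j hj)
      have h3 := ih (J.erase i) (Finset.erase_ssubset hi) ((Finset.erase_subset i J).trans hJJ) ε
        fun j hj ↦ hε j (Finset.mem_of_mem_erase hj)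
      have h4 : -Function.update ε i (-ε i) = Function.update (-ε) i (-(-ε) i) := by
        ext1 j
        by_cases hj : j = i
        · subst hj; simp
        · simp [hj]
      simp only [hδ]
      rw [h4]
      linear_combination h1 - (-1) ^ d * h2 + h3
    obtain ⟨c, hc0, j, hjne⟩ := Fintype.not_linearIndependent_iff.1 hli
    let ε' : ι → SignType := fun i ↦ if h : i ∈ J then
      (if c ⟨i, h⟩ = 0 then 1 else SignType.sign (c ⟨i, h⟩)) else 1
    have hε' : ∀ i ∈ J, ε' i ≠ 0 := by
      intro i hi
      simp only [ε', dif_pos hi]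
      split_ifs with h
      · decide
      · simpa using h
    have hne : ∀ x, ∀ t : ℝ, t ≠ 0 →
        ¬ ∀ i ∈ J, SignType.sign (n i (p x)) = SignType.sign t * ε' i := by
      intro x t ht hx
      have hsum : ∑ i : J, c i * n i (p x) = 0 := by
        have := congrArg (fun f : U →ₗ[ℝ] ℝ ↦ f (p x)) hc0
        simpa using this
      have hterm : ∀ i : J, t * (c i * n i (p x)) = |t * (c i * n i (p x))| := by
        intro i
        have h := hx i i.2
        simp only [ε', dif_pos i.2] at h
        by_cases hci : c i = 0
        · simp [hci]
        · rw [if_neg (by simpa using hci)] at h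
          rw [eq_comm, abs_eq_self, ← sign_nonneg_iff, sign_mul, sign_mul, h]
          generalize SignType.sign t = a
          generalize SignType.sign (c ⟨↑i, _⟩) = a'
          revert a a'; decide
      have hzero : ∑ i : J, |t * (c i * n i (p x))| = 0 := by
        rw [← Finset.sum_congr rfl fun i _ ↦ hterm i, ← Finset.mul_sum, hsum, mul_zero]
      have := (Finset.sum_eq_zero_iff_of_nonneg fun i _ ↦ abs_nonneg _).1 hzero j
        (Finset.mem_univ j)
      rw [abs_eq_zero] at this
      exact mul_ne_zero ht (mul_ne_zero hjne (hp x j (hJJ j.2))) this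
    have hδ' : δ ε' = 0 := by
      have h1 : g J ε' = 0 := signSum_eq_zero fun x ↦ by simpa using hne x 1 one_ne_zero
      have h2 : g J (-ε') = 0 := signSum_eq_zero fun x ↦ by simpa using hne x (-1) (by simp)
      simp only [hδ, h1, h2, mul_zero, sub_zero]
    have hfin : δ ε = 0 := by
      have hT := apply_piecewise_neg (f := δ) (J := J) (T := J.filter fun i ↦ ε i ≠ ε' i) hδneg
        hε' (Finset.filter_subset _ _)
      rw [hδ', mul_zero] at hT
      rw [← hT]
      have he : ∀ i ∈ J, ε i = (J.filter fun i ↦ ε i ≠ ε' i).piecewise (-ε') ε' i := by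
        intro i hi
        by_cases hi' : ε i = ε' i
        · rw [Finset.piecewise_eq_of_notMem _ _ _ (by simp [hi']), hi']
        · rw [Finset.piecewise_eq_of_mem _ _ _ (by simp [hi', hi])]
          exact (SignType.eq_or_eq_neg_of_ne_zero (hε i hi) (hε' i hi)).resolve_left hi'
      simp only [hδ, hg]
      rw [signSum_congr he, signSum_congr (J := J) (ε := -ε) fun i hi ↦ congrArg Neg.neg (he i hi)]
      rfl
    exact sub_eq_zero.1 hfin

end SignSums

/-- Linearly independent functionals cut out a subspace of the expected dimension. -/
lemma finrank_iInf_ker_add_card {U ι : Type*} [AddCommGroup U] [Module ℝ U] [FiniteDimensional ℝ U]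
    (n : ι → U →ₗ[ℝ] ℝ) (J : Finset ι) (h : LinearIndependent ℝ (fun i : J ↦ n i)) :
    Module.finrank ℝ (⨅ i ∈ J, LinearMap.ker (n i) : Submodule ℝ U) + J.card =
      Module.finrank ℝ U := by
  have h1 := Subspace.finrank_add_finrank_dualCoannihilator_eq
    (Submodule.span ℝ (Set.range fun i : J ↦ (n i : Module.Dual ℝ U)))
  rw [finrank_span_eq_card h, Fintype.card_coe] at h1
  have h2 : (⨅ i ∈ J, LinearMap.ker (n i) : Submodule ℝ U) =
      (Submodule.span ℝ (Set.range fun i : J ↦ (n i : Module.Dual ℝ U))).dualCoannihilator := by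
    ext v
    simp only [Submodule.mem_iInf, LinearMap.mem_ker, Submodule.mem_dualCoannihilator]
    refine ⟨fun hv φ hφ ↦ ?_, fun hv i hi ↦ hv _ (Submodule.subset_span ⟨⟨i, hi⟩, rfl⟩)⟩
    induction hφ using Submodule.span_induction with
    | mem φ hφ => obtain ⟨i, rfl⟩ := hφ; exact hv i i.2
    | zero => rfl
    | add φ ψ _ _ h h' => rw [LinearMap.add_apply, h, h', add_zero]
    | smul c φ _ h => rw [LinearMap.smul_apply, h, smul_zero]
  rw [← h1, add_comm, h2]

namespace FaceQuiver

variable {V : Type*} [NormedAddCommGroup V] [InnerProductSpace ℝ V]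
variable {W : Subgroup (V ≃ₗᵢ[ℝ] V)}

/-! ### Faces, supports and flats -/

section Lattice

variable [FiniteDimensional ℝ V]

lemma Face.carrier_subset_supp (x : Face W) : x.carrier ⊆ supp x := fun _ hv ↦
  Submodule.mem_sInf.2 fun _ hH ↦ hH.2 hv

lemma Face.sign_eq_zero_iff (x : Face W) (H : arrangement W) :
    x.sign H = 0 ↔ x.flat.1 ≤ (H : Submodule ℝ V) := by
  constructor
  · intro h
    refine sInf_le ⟨H.2, fun v hv ↦ ?_⟩
    rw [SetLike.mem_coe, ← side_eq_zero, x.mem_iff.1 hv, h]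
  · intro h
    obtain ⟨v, hv⟩ := x.nonempty
    rw [← x.mem_iff.1 hv, side_eq_zero]
    exact h (x.carrier_subset_supp hv)

lemma Face.exists_flat_eq (X : Flat W) : ∃ x : Face W, x.flat = X := by
  obtain ⟨x, hx⟩ := X.2
  exact ⟨x, Subtype.ext hx⟩

/-- A flat is the intersection of the hyperplanes that contain it. -/
lemma Flat.mem_of_forall {X : Flat W} {v : V}
    (h : ∀ H : arrangement W, X.1 ≤ H → v ∈ (H : Submodule ℝ V)) : v ∈ X.1 := by
  obtain ⟨x, rfl⟩ := Face.exists_flat_eq X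
  refine Submodule.mem_sInf.2 fun H hH ↦ h ⟨H, hH.1⟩ (sInf_le hH)

lemma Flat.le_iff {X Z : Flat W} :
    X ≤ Z ↔ ∀ H : arrangement W, Z.1 ≤ H → X.1 ≤ (H : Submodule ℝ V) :=
  ⟨fun h _ hH ↦ le_trans (show X.1 ≤ Z.1 from h) hH,
    fun h _ hv ↦ Flat.mem_of_forall fun H hH ↦ h H hH hv⟩

lemma Face.flat_of_le_iff {v : V} {Z : Flat W} : (Face.of W v).flat ≤ Z ↔ v ∈ Z.1 := by
  constructor
  · intro h
    exact (show (Face.of W v).flat.1 ≤ Z.1 from h) (Face.carrier_subset_supp _ (Face.mem_of v))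
  · intro h
    rw [Flat.le_iff]
    intro H hH
    rw [← Face.sign_eq_zero_iff, Face.sign_of, side_eq_zero]
    exact hH h

lemma Face.flat_eq_of_sign {x y : Face W} (h : ∀ H, x.sign H = 0 ↔ y.sign H = 0) :
    x.flat = y.flat := by
  have key : ∀ {x y : Face W}, (∀ H, x.sign H = 0 ↔ y.sign H = 0) → x.flat ≤ y.flat := by
    intro x y h
    rw [Flat.le_iff]
    intro H hH
    rwa [← Face.sign_eq_zero_iff, h, Face.sign_eq_zero_iff]
  exact le_antisymm (key h) (key fun H ↦ (h H).symm)

variable [Finite W]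

lemma Face.sign_mul_apply (x y : Face W) (H : arrangement W) :
    (x * y).sign H = if x.sign H ≠ 0 then x.sign H else y.sign H := by
  rw [Face.sign_mul, mulSign]

lemma Face.sign_mul_eq_zero {x y : Face W} {H : arrangement W} :
    (x * y).sign H = 0 ↔ x.sign H = 0 ∧ y.sign H = 0 := by
  rw [Face.sign_mul_apply]
  split_ifs with h <;> simp_all

lemma Face.flat_mul_le {x y : Face W} {Z : Flat W} :
    (x * y).flat ≤ Z ↔ x.flat ≤ Z ∧ y.flat ≤ Z := by
  simp only [Flat.le_iff, ← Face.sign_eq_zero_iff, Face.sign_mul_eq_zero]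
  exact ⟨fun h ↦ ⟨fun H hH ↦ (h H hH).1, fun H hH ↦ (h H hH).2⟩,
    fun h H hH ↦ ⟨h.1 H hH, h.2 H hH⟩⟩

lemma Face.flat_le_mul_left (x y : Face W) : x.flat ≤ (x * y).flat :=
  (Face.flat_mul_le.1 le_rfl).1

lemma Face.flat_le_mul_right (x y : Face W) : y.flat ≤ (x * y).flat :=
  (Face.flat_mul_le.1 le_rfl).2

lemma Face.flat_mul_eq {x y : Face W} (h : x.flat ≤ y.flat) : (x * y).flat = y.flat :=
  le_antisymm (Face.flat_mul_le.2 ⟨h, le_rfl⟩) (Face.flat_le_mul_right x y)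

lemma Face.mul_eq_left {x y : Face W} (h : y.flat ≤ x.flat) : x * y = x := by
  refine Face.eq_of_sign (funext fun H ↦ ?_)
  rw [Face.sign_mul_apply]
  split_ifs with hx
  · rfl
  · rw [not_not, Face.sign_eq_zero_iff] at hx
    rw [(Face.sign_eq_zero_iff x H).2 hx, Face.sign_eq_zero_iff]
    exact le_trans (show y.flat.1 ≤ x.flat.1 from h) hx

/-- Every intersection of hyperplanes of the arrangement is a flat. Among the faces that it
contains, one that lies on as few hyperplanes as possible has it as its support. -/
lemma Flat.exists_eq_sInf (S : Set (arrangement W)) :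
    ∃ Z : Flat W, ∀ v, v ∈ Z.1 ↔ ∀ H ∈ S, v ∈ (H : Submodule ℝ V) := by
  classical
  let _ := Fintype.ofFinite (arrangement W)
  let T : Set (Face W) := {x | ∀ H ∈ S, x.sign H = 0}
  have hT : T.Nonempty := ⟨1, fun H _ ↦ by rw [Face.sign_one]⟩
  obtain ⟨x, hxT, hx⟩ := T.toFinite.exists_minimalFor
    (fun x : Face W ↦ Finset.univ.filter fun H ↦ x.sign H = 0) T hT
  refine ⟨x.flat, fun v ↦ ⟨fun hv H hH ↦ (x.sign_eq_zero_iff H).1 (hxT H hH) hv, fun hv ↦ ?_⟩⟩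
  refine Flat.mem_of_forall fun H hH ↦ ?_
  have hmul : x * Face.of W v ∈ T := fun K hK ↦ Face.sign_mul_eq_zero.2
    ⟨hxT K hK, by rw [Face.sign_of, side_eq_zero]; exact hv K hK⟩
  have hle := hx hmul fun K hK ↦ by
    simp only [Finset.mem_filter, Finset.mem_univ, true_and] at hK ⊢
    exact (Face.sign_mul_eq_zero.1 hK).1
  have h0 := hle (Finset.mem_filter.2 ⟨Finset.mem_univ H, (x.sign_eq_zero_iff H).2 hH⟩)
  simp only [Finset.mem_filter, Finset.mem_univ, true_and, Face.sign_mul_eq_zero, Face.sign_of,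
    side_eq_zero] at h0
  exact h0.2

end Lattice

/-! ### Linear combinations of faces -/

section Algebra

variable [FiniteDimensional ℝ V] [Finite W] {k : Type*} [Field k]

/-- The linear combinations of the faces that satisfy `P`. -/
def faceSpan (k : Type*) [Field k] (P : Face W → Prop) : Submodule k (MonoidAlgebra k (Face W)) :=
  Submodule.span k ((fun x ↦ MonoidAlgebra.single x 1) '' {x | P x})

variable {P Q R : Face W → Prop}

lemma single_mem_faceSpan {x : Face W} (hx : P x) :
    MonoidAlgebra.single x 1 ∈ faceSpan k P := Submodule.subset_span ⟨x, hx, rfl⟩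

lemma eq_sum_smul_single [Fintype (Face W)] (a : MonoidAlgebra k (Face W)) :
    a = ∑ x, a.coeff x • MonoidAlgebra.single x 1 := by
  conv_lhs => rw [← MonoidAlgebra.sum_coeff_single a]
  rw [Finsupp.sum_fintype _ _ (by simp)]
  simp

lemma faceSpan_le {p : Submodule k (MonoidAlgebra k (Face W))}
    (h : ∀ x, P x → MonoidAlgebra.single x 1 ∈ p) : faceSpan k P ≤ p :=
  Submodule.span_le.2 (by rintro _ ⟨x, hx, rfl⟩; exact h x hx)

/-- The coefficient of a face, as a linear map. -/
def coeffAt (x : Face W) : MonoidAlgebra k (Face W) →ₗ[k] k where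
  toFun a := a.coeff x
  map_add' _ _ := rfl
  map_smul' _ _ := rfl

lemma coeffAt_apply (x : Face W) (a : MonoidAlgebra k (Face W)) : coeffAt x a = a.coeff x := rfl

open Classical in
lemma coeffAt_single (x y : Face W) :
    coeffAt x (MonoidAlgebra.single y (1 : k)) = if y = x then 1 else 0 := by
  rw [coeffAt_apply, MonoidAlgebra.coeff_single, Finsupp.single_apply]

lemma mem_faceSpan {a : MonoidAlgebra k (Face W)} :
    a ∈ faceSpan k P ↔ ∀ x, a.coeff x ≠ 0 → P x := by
  classical
  constructor
  · intro ha
    contrapose! ha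
    obtain ⟨x, hx, hP⟩ := ha
    intro h
    have : faceSpan k P ≤ LinearMap.ker (coeffAt x) := faceSpan_le fun y hy ↦ by
      rw [LinearMap.mem_ker, coeffAt_single, if_neg]
      rintro rfl
      exact hP hy
    exact hx (this h)
  · intro h
    let _ := Fintype.ofFinite (Face W)
    rw [eq_sum_smul_single a]
    refine Submodule.sum_mem _ fun x _ ↦ ?_
    by_cases hx : a.coeff x = 0
    · simp [hx]
    · exact Submodule.smul_mem _ _ (single_mem_faceSpan (h x hx))

lemma faceSpan_mono (h : ∀ x, P x → Q x) : faceSpan k P ≤ faceSpan k Q :=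
  faceSpan_le fun x hx ↦ single_mem_faceSpan (h x hx)

lemma mem_faceSpan_true (a : MonoidAlgebra k (Face W)) : a ∈ faceSpan k fun _ : Face W ↦ True :=
  mem_faceSpan.2 fun _ _ ↦ trivial

lemma mul_mem_faceSpan {a b : MonoidAlgebra k (Face W)} (ha : a ∈ faceSpan k P)
    (hb : b ∈ faceSpan k Q) (h : ∀ x y, P x → Q y → R (x * y)) : a * b ∈ faceSpan k R := by
  have h1 : ∀ x, P x → MonoidAlgebra.single x 1 * b ∈ faceSpan k R := fun x hx ↦ by
    have : faceSpan k Q ≤ (faceSpan k R).comap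
        (LinearMap.mulLeft k (MonoidAlgebra.single x (1 : k))) := faceSpan_le fun y hy ↦ by
      simpa [MonoidAlgebra.single_mul_single] using single_mem_faceSpan (h x y hx hy)
    exact this hb
  have : faceSpan k P ≤ (faceSpan k R).comap (LinearMap.mulRight k b) := faceSpan_le h1
  exact this ha

/-- Two linear maps that agree on the faces satisfying `P` agree on `faceSpan k P`. -/
lemma eq_of_mem_faceSpan {M : Type*} [AddCommMonoid M] [Module k M]
    {f g : MonoidAlgebra k (Face W) →ₗ[k] M}
    (h : ∀ x, P x → f (MonoidAlgebra.single x 1) = g (MonoidAlgebra.single x 1))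
    {a : MonoidAlgebra k (Face W)} (ha : a ∈ faceSpan k P) : f a = g a :=
  LinearMap.eqOn_span (by rintro _ ⟨x, hx, rfl⟩; exact h x hx) ha

lemma coeff_act (w : W) (a : MonoidAlgebra k (Face W)) (x : Face W) :
    (act k w a).coeff (w • x) = a.coeff x :=
  Finsupp.mapDomain_apply (MulAction.injective w) a.coeff x

end Algebra

/-! ### The elements `e_X` -/

namespace EllFamily

variable [FiniteDimensional ℝ V] [Finite W] {k : Type*} [Field k] (ℓ : EllFamily k W)

lemma ell_mem (X : Flat W) : ℓ.ell X ∈ faceSpan k fun x ↦ x.flat = X :=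
  mem_faceSpan.2 (ℓ.supp_eq X)

open Classical in
lemma idem_eq_sub_sum (X : Flat W) [Fintype (Flat W)] :
    ℓ.idem X = ℓ.ell X - ∑ Y with X < Y, ℓ.ell X * ℓ.idem Y := by
  rw [idem_eq, ← Finset.sum_subtype_eq_sum_filter (f := fun Y ↦ ℓ.ell X * ℓ.idem Y)]
  congr 1
  refine Finset.sum_bij' (fun Z _ ↦ ⟨Z.1, by simpa using Z.2⟩) (fun Z _ ↦ ⟨Z.1, by simpa using Z.2⟩)
    ?_ ?_ ?_ ?_ ?_ <;> simp

/-- If `x` has support containing `X`, then `x y = x` for all faces `y` of support `X`. -/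
lemma mul_ell {X : Flat W} {a : MonoidAlgebra k (Face W)}
    (ha : a ∈ faceSpan k fun x ↦ X ≤ x.flat) : a * ℓ.ell X = a := by
  refine eq_of_mem_faceSpan (f := LinearMap.mulRight k (ℓ.ell X)) (g := LinearMap.id)
    (fun x hx ↦ ?_) ha
  simp only [LinearMap.mulRight_apply, LinearMap.id_apply]
  let _ := Fintype.ofFinite (Face W)
  have h1 : MonoidAlgebra.single x 1 * ℓ.ell X =
      ∑ y, (ℓ.ell X).coeff y • MonoidAlgebra.single x (1 : k) := by
    conv_lhs => rw [eq_sum_smul_single (ℓ.ell X), Finset.mul_sum]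
    refine Finset.sum_congr rfl fun y _ ↦ ?_
    by_cases hy : (ℓ.ell X).coeff y = 0
    · simp [hy]
    · rw [mul_smul_comm, MonoidAlgebra.single_mul_single, one_mul,
        Face.mul_eq_left ((ℓ.supp_eq X y hy).trans_le hx)]
  have h2 := ℓ.sum_eq_one X
  rw [Finsupp.sum_fintype _ _ (by simp)] at h2
  rw [h1, ← Finset.sum_smul, h2, one_smul]

lemma idem_mem (X : Flat W) : ℓ.idem X ∈ faceSpan k fun x ↦ X ≤ x.flat := by
  classical
  let _ := Fintype.ofFinite (Flat W)
  induction X using (wellFounded_gt (α := Flat W)).induction with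
  | _ X ih =>
    rw [idem_eq]
    refine Submodule.sub_mem _ (faceSpan_mono (fun x hx ↦ hx.ge) (ℓ.ell_mem X))
      (Submodule.sum_mem _ fun Y _ ↦ mul_mem_faceSpan (ℓ.ell_mem X) (ih Y.1 Y.2) fun x y hx _ ↦ ?_)
    exact hx.ge.trans (Face.flat_le_mul_left x y)

lemma idem_sub_ell_mem (X : Flat W) : ℓ.idem X - ℓ.ell X ∈ faceSpan k fun x ↦ X < x.flat := by
  classical
  let _ := Fintype.ofFinite (Flat W)
  rw [idem_eq, sub_sub_cancel_left]
  refine Submodule.neg_mem _ (Submodule.sum_mem _ fun Y _ ↦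
    mul_mem_faceSpan (ℓ.ell_mem X) (ℓ.idem_mem Y.1) fun x y _ hy ↦ ?_)
  exact Y.2.trans_le (hy.trans (Face.flat_le_mul_right x y))

lemma ell_mul_idem (X : Flat W) : ℓ.ell X * ℓ.idem X = ℓ.idem X := by
  classical
  let _ := Fintype.ofFinite (Flat W)
  have h : ℓ.ell X * ℓ.ell X = ℓ.ell X :=
    ℓ.mul_ell (faceSpan_mono (fun x hx ↦ hx.ge) (ℓ.ell_mem X))
  rw [idem_eq, mul_sub, h, Finset.mul_sum]
  simp only [← mul_assoc, h]

open Classical in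
/-- The sum of the `e_Z` over the flats `Z` containing the support of `x` is a right identity for
`x`. -/
lemma mul_sum_idem [Fintype (Flat W)] (x : Face W) :
    ∑ Z with x.flat ≤ Z, MonoidAlgebra.single x 1 * ℓ.idem Z = MonoidAlgebra.single x 1 := by
  have h1 : (Finset.univ.filter fun Z ↦ x.flat ≤ Z) =
      insert x.flat (Finset.univ.filter fun Z ↦ x.flat < Z) := by
    ext Z
    simp [le_iff_eq_or_lt, eq_comm]
  have h2 : MonoidAlgebra.single x 1 * ℓ.ell x.flat = MonoidAlgebra.single x 1 :=
    ℓ.mul_ell (single_mem_faceSpan le_rfl)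
  rw [h1, Finset.sum_insert (by simp), idem_eq_sub_sum, mul_sub, Finset.mul_sum, h2]
  simp only [← mul_assoc, h2]
  rw [sub_add_cancel]

/-- A combination of faces whose support is not contained in `Y` annihilates `e_Y`. -/
lemma mul_idem_eq_zero {Y : Flat W} {a : MonoidAlgebra k (Face W)}
    (ha : a ∈ faceSpan k fun x ↦ ¬ x.flat ≤ Y) : a * ℓ.idem Y = 0 := by
  classical
  let _ := Fintype.ofFinite (Flat W)
  induction Y using (wellFounded_gt (α := Flat W)).induction generalizing a with
  | _ Y ih =>
    have hb : a * ℓ.ell Y ∈ faceSpan k fun x ↦ Y < x.flat :=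
      mul_mem_faceSpan ha (ℓ.ell_mem Y) fun x y hx hy ↦
        lt_of_le_of_ne (hy.ge.trans (Face.flat_le_mul_right x y)) fun h ↦
          hx (h ▸ Face.flat_le_mul_left x y)
    rw [idem_eq_sub_sum, mul_sub, Finset.mul_sum, sub_eq_zero]
    simp only [← mul_assoc]
    refine (eq_of_mem_faceSpan (f := ∑ Z with Y < Z, LinearMap.mulRight k (ℓ.idem Z))
      (g := LinearMap.id) (fun x hx ↦ ?_) hb).symm.trans (by simp)
    simp only [LinearMap.sum_apply, LinearMap.mulRight_apply, LinearMap.id_apply]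
    refine Eq.trans (Finset.sum_subset ?_ fun Z hZ hZ' ↦ ?_).symm (ℓ.mul_sum_idem x)
    · intro Z hZ
      simp only [Finset.mem_filter, Finset.mem_univ, true_and] at hZ ⊢
      exact hx.trans_le hZ
    · simp only [Finset.mem_filter, Finset.mem_univ, true_and] at hZ hZ'
      exact ih Z hZ (single_mem_faceSpan hZ')

lemma mul_idem_mem (Y : Flat W) (a : MonoidAlgebra k (Face W)) :
    ∃ a' ∈ faceSpan k (fun x ↦ x.flat = Y), a * ℓ.idem Y = a' * ℓ.idem Y := by
  have h : faceSpan k (fun _ : Face W ↦ True) ≤ ((faceSpan k fun x ↦ x.flat = Y).map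
      (LinearMap.mulRight k (ℓ.idem Y))).comap (LinearMap.mulRight k (ℓ.idem Y)) := by
    refine faceSpan_le fun x _ ↦ ?_
    by_cases hx : x.flat ≤ Y
    · refine ⟨MonoidAlgebra.single x 1 * ℓ.ell Y, mul_mem_faceSpan
        (P := fun y ↦ y = x) (single_mem_faceSpan rfl) (ℓ.ell_mem Y) ?_, ?_⟩
      · rintro _ y rfl rfl
        exact Face.flat_mul_eq hx
      · simp only [LinearMap.mulRight_apply]
        rw [mul_assoc, ℓ.ell_mul_idem]
    · refine ⟨0, Submodule.zero_mem _, ?_⟩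
      rw [map_zero, LinearMap.mulRight_apply, ℓ.mul_idem_eq_zero (single_mem_faceSpan hx)]
  obtain ⟨a', ha', h'⟩ := h (mem_faceSpan_true a)
  exact ⟨a', ha', h'.symm⟩

lemma mul_idem_mem_faceSpan (Y : Flat W) (a : MonoidAlgebra k (Face W)) :
    a * ℓ.idem Y ∈ faceSpan k fun x ↦ Y ≤ x.flat :=
  mul_mem_faceSpan (mem_faceSpan_true a) (ℓ.idem_mem Y) fun x y _ hy ↦
    hy.trans (Face.flat_le_mul_right x y)

/-- The elements of `kℱ e_Y` are determined by their coefficients at the faces of support `Y`. -/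
lemma mul_idem_eq_zero_of_coeff {Y : Flat W} {a : MonoidAlgebra k (Face W)}
    (h : ∀ x : Face W, x.flat = Y → (a * ℓ.idem Y).coeff x = 0) : a * ℓ.idem Y = 0 := by
  obtain ⟨a', ha', h'⟩ := ℓ.mul_idem_mem Y a
  have h1 : a' * ℓ.idem Y = a' + a' * (ℓ.idem Y - ℓ.ell Y) := by
    rw [mul_sub, ℓ.mul_ell (faceSpan_mono (fun x hx ↦ hx.ge) ha')]
    abel
  have h2 : a' * (ℓ.idem Y - ℓ.ell Y) ∈ faceSpan k fun x ↦ Y < x.flat :=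
    mul_mem_faceSpan ha' (ℓ.idem_sub_ell_mem Y) fun x y _ hy ↦
      hy.trans_le (Face.flat_le_mul_right x y)
  have h3 : a' = 0 := by
    ext x
    by_contra hx
    have hxY := mem_faceSpan.1 ha' x hx
    have h4 := h x hxY
    rw [h', h1, MonoidAlgebra.coeff_add, Finsupp.add_apply, (not_imp_comm.1 (mem_faceSpan.1 h2 x))
      (by rw [hxY]; exact lt_irrefl Y), add_zero] at h4
    exact hx h4
  rw [h', h3, zero_mul]

end EllFamily

end FaceQuiver

namespace FaceQuiver

variable {V : Type*} [NormedAddCommGroup V] [InnerProductSpace ℝ V] [FiniteDimensional ℝ V]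
variable {W : Subgroup (V ≃ₗᵢ[ℝ] V)} [Finite W] {k : Type*} [Field k]

/-! ### The antipodal map on `e_X kℱ e_Y` -/

open Classical in
/-- The sum of the coefficients of the faces of support `Y` with signs `ε` on `J`. -/
def faceSignSum (k : Type*) [Field k] (Y : Flat W) (J : Finset (arrangement W))
    (ε : arrangement W → SignType) : MonoidAlgebra k (Face W) →ₗ[k] k :=
  let _ := Fintype.ofFinite (Face W)
  ∑ x with x.flat = Y ∧ ∀ H ∈ J, x.sign H = ε H, coeffAt x

variable {X Y : Flat W} {J : Finset (arrangement W)} {ε : arrangement W → SignType}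
  {b : MonoidAlgebra k (Face W)}

open Classical in
lemma faceSignSum_single (x : Face W) :
    faceSignSum k Y J ε (MonoidAlgebra.single x 1) =
      if x.flat = Y ∧ ∀ H ∈ J, x.sign H = ε H then 1 else 0 := by
  simp [faceSignSum, coeffAt_single]

/-- Multiplication by a face `w` affects neither supports containing that of `w` nor the signs at
hyperplanes containing `w`. -/
lemma faceSignSum_single_mul {w : Face W} (hw : w.flat ≤ Y) (hJ : ∀ H ∈ J, w.sign H = 0)
    (hb : b ∈ faceSpan k fun x ↦ Y ≤ x.flat) :
    faceSignSum k Y J ε (MonoidAlgebra.single w 1 * b) = faceSignSum k Y J ε b := by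
  classical
  refine eq_of_mem_faceSpan
    (f := faceSignSum k Y J ε ∘ₗ LinearMap.mulLeft k (MonoidAlgebra.single w (1 : k)))
    (fun x hx ↦ ?_) hb
  rw [LinearMap.comp_apply, LinearMap.mulLeft_apply, MonoidAlgebra.single_mul_single, one_mul,
    faceSignSum_single, faceSignSum_single, Face.flat_mul_eq (hw.trans hx)]
  congr 2
  exact propext (forall₂_congr fun H hH ↦ by rw [Face.sign_mul_apply, hJ H hH]; simp)

open Classical in
/-- The hyperplanes of the arrangement that contain `X` but not `Y`. -/
def between (X Y : Flat W) : Finset (arrangement W) :=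
  let _ := Fintype.ofFinite (arrangement W)
  {H : arrangement W | X.1 ≤ (H : Submodule ℝ V) ∧ ¬ Y.1 ≤ (H : Submodule ℝ V)}

lemma mem_between {H : arrangement W} :
    H ∈ between X Y ↔ X.1 ≤ (H : Submodule ℝ V) ∧ ¬ Y.1 ≤ (H : Submodule ℝ V) := by
  simp [between]

open Classical in
/-- Multiplication by a face `x` of support `X` turns the coefficients at the faces `y ≥ x` of
support `Y` into sums over sign conditions. -/
lemma coeff_single_mul {x y : Face W} (hx : x.flat = X) (hy : y.flat = Y)
    (hb : b ∈ faceSpan k fun x ↦ Y ≤ x.flat) :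
    (MonoidAlgebra.single x 1 * b).coeff y =
      if x * y = y then faceSignSum k Y (between X Y) y.sign b else 0 := by
  refine eq_of_mem_faceSpan
    (f := coeffAt y ∘ₗ LinearMap.mulLeft k (MonoidAlgebra.single x (1 : k)))
    (g := if x * y = y then faceSignSum k Y (between X Y) y.sign else 0)
    (fun u hu ↦ ?_) hb |>.trans (by split_ifs <;> rfl)
  rw [LinearMap.comp_apply, LinearMap.mulLeft_apply, MonoidAlgebra.single_mul_single, one_mul,
    coeffAt_single]
  split_ifs with h1 h2 h2
  · rw [faceSignSum_single, if_pos]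
    refine ⟨le_antisymm ((Face.flat_le_mul_right x u).trans_eq (h1 ▸ hy)) hu, fun H hH ↦ ?_⟩
    have hxH : x.sign H = 0 := (Face.sign_eq_zero_iff x H).2 (hx ▸ (mem_between.1 hH).1)
    rw [← h1, Face.sign_mul_apply, hxH]
    simp
  · exact absurd (by rw [← h1, ← mul_assoc, Face.mul_eq_left le_rfl]) h2
  · rw [faceSignSum_single, if_neg]
    · rintro ⟨huY, hu'⟩
      refine h1 (Face.eq_of_sign (funext fun H ↦ ?_))
      have hxy := congrFun (congrArg Face.sign h2) H
      rw [Face.sign_mul_apply] at hxy ⊢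
      split_ifs at hxy ⊢ with hxH
      · exact hxy
      · rw [not_not, Face.sign_eq_zero_iff, hx] at hxH
        by_cases hYH : Y.1 ≤ (H : Submodule ℝ V)
        · rw [(Face.sign_eq_zero_iff u H).2 (huY ▸ hYH), (Face.sign_eq_zero_iff y H).2 (hy ▸ hYH)]
        · exact hu' H (mem_between.2 ⟨hxH, hYH⟩)
  · rfl

/-- If all faces whose support is not contained in `X` annihilate `b`, then so do sums over sign
conditions that are met by such a face with zeros. -/
lemma faceSignSum_eq_zero (hb : b ∈ faceSpan k fun x ↦ Y ≤ x.flat)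
    (hX : ∀ w : Face W, ¬ w.flat ≤ X → MonoidAlgebra.single w 1 * b = 0) {v : V} (hvY : v ∈ Y.1)
    (hvX : v ∉ X.1) (hJ : ∀ H ∈ J, v ∈ (H : Submodule ℝ V)) : faceSignSum k Y J ε b = 0 := by
  rw [← faceSignSum_single_mul (w := Face.of W v) (Face.flat_of_le_iff.2 hvY)
    (fun H hH ↦ by rw [Face.sign_of, side_eq_zero]; exact hJ H hH) hb,
    hX _ (mt Face.flat_of_le_iff.1 hvX), map_zero]

/-- Reversing the signs of all hyperplanes between `X` and `Y` multiplies the sums by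
`(-1) ^ (dim Y - dim X)`. -/
lemma faceSignSum_between_neg (hXY : X ≤ Y) (hb : b ∈ faceSpan k fun x ↦ Y ≤ x.flat)
    (hX : ∀ w : Face W, ¬ w.flat ≤ X → MonoidAlgebra.single w 1 * b = 0)
    (hε : ∀ H ∈ between X Y, ε H ≠ 0) :
    faceSignSum k Y (between X Y) ε b =
      (-1) ^ (Module.finrank ℝ Y.1 - Module.finrank ℝ X.1) *
        faceSignSum k Y (between X Y) (-ε) b := by
  classical
  let _ := Fintype.ofFinite (Face W)
  let n : arrangement W → Y.1 →ₗ[ℝ] ℝ := fun H ↦ (innerₛₗ ℝ (normal H)) ∘ₗ Y.1.subtype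
  have hn : ∀ H v, n H v = 0 ↔ (v : V) ∈ (H : Submodule ℝ V) := fun H v ↦ by
    rw [← side_eq_zero, side, sign_eq_zero_iff]
    rfl
  let p : {x : Face W // x.flat = Y} → Y.1 := fun x ↦
    ⟨x.1.nonempty.some,
      (congrArg Subtype.val x.2).le (x.1.carrier_subset_supp x.1.nonempty.some_mem)⟩
  have hsign : ∀ x H, SignType.sign (n H (p x)) = x.1.sign H := fun x H ↦
    x.1.mem_iff.1 x.1.nonempty.some_mem H
  have hsum : ∀ J ε, signSum (fun x H ↦ SignType.sign (n H (p x)))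
      (fun x : {x : Face W // x.flat = Y} ↦ b.coeff x.1) J ε = faceSignSum k Y J ε b := by
    intro J ε
    simp only [signSum, hsign, faceSignSum, LinearMap.sum_apply, coeffAt_apply]
    refine Finset.sum_bij (fun x _ ↦ x.1) (fun x hx ↦ ?_) (fun x _ y _ h ↦ Subtype.ext h)
      (fun x hx ↦ ?_) (fun _ _ ↦ rfl)
    · simpa [x.2] using hx
    · simp only [Finset.mem_filter, Finset.mem_univ, true_and] at hx
      exact ⟨⟨x, hx.1⟩, by simpa using hx.2, rfl⟩
  have hXfin : Module.finrank ℝ (X.1.comap Y.1.subtype) = Module.finrank ℝ X.1 :=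
    (Submodule.comapSubtypeEquivOfLe (show X.1 ≤ Y.1 from hXY)).finrank_eq
  have hvanish : ∀ J : Finset (arrangement W),
      ¬ (⨅ H ∈ J, LinearMap.ker (n H)) ≤ X.1.comap Y.1.subtype → ∀ ε,
      faceSignSum k Y J ε b = 0 := by
    intro J hJ ε
    obtain ⟨v, hv, hvX⟩ := SetLike.not_le_iff_exists.1 hJ
    refine faceSignSum_eq_zero hb hX v.2 hvX fun H hH ↦ ?_
    simp only [Submodule.mem_iInf, LinearMap.mem_ker] at hv
    exact (hn H v).1 (hv H hH)
  rw [← hsum, ← hsum]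
  refine signSum_neg n p _ (between X Y) (fun x H hH h0 ↦ ?_) _ (fun J hJ hli ↦ ?_) _
    subset_rfl ε hε
  · rw [← sign_eq_zero_iff, hsign, Face.sign_eq_zero_iff, x.2] at h0
    exact (mem_between.1 hH).2 h0
  simp only [hsum]
  by_cases hle : (⨅ H ∈ J, LinearMap.ker (n H)) ≤ X.1.comap Y.1.subtype
  swap
  · exact Or.inl (hvanish J hle)
  have heq : (⨅ H ∈ J, LinearMap.ker (n H)) = X.1.comap Y.1.subtype := by
    refine le_antisymm hle (le_iInf₂ fun H hH v hv ↦ ?_)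
    exact (hn H v).2 ((mem_between.1 (hJ hH)).1 hv)
  have hdim := finrank_iInf_ker_add_card n J hli
  rw [heq, hXfin] at hdim
  refine Or.inr ⟨by omega, fun H hH J' hJ' hHJ' ε ↦ hvanish J' (fun hle' ↦ ?_) ε⟩
  have hdim' := finrank_iInf_ker_add_card n J'
    (hli.comp (Set.inclusion hJ') (Set.inclusion_injective hJ'))
  have hcard : J'.card < J.card :=
    Finset.card_lt_card ⟨hJ', fun h ↦ hHJ' (h hH)⟩
  have := Submodule.finrank_mono hle'
  omega

lemma antipode_smul_flat {z : W} (hz : ∀ x : Face W, (z • x).sign = -x.sign) (X : Flat W) :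
    z • X = X := by
  obtain ⟨x, rfl⟩ := Face.exists_flat_eq X
  rw [← Face.flat_smul]
  exact Face.flat_eq_of_sign fun H ↦ by rw [hz, Pi.neg_apply, SignType.neg_eq_zero_iff]

lemma antipode_smul_smul {z : W} (hz : ∀ x : Face W, (z • x).sign = -x.sign) (x : Face W) :
    z • z • x = x :=
  Face.eq_of_sign (by rw [hz, hz, neg_neg])

namespace EllFamily

variable (ℓ : EllFamily k W)

/-- The sign rule for the antipodal map, at faces of support `Y`: expand `ℓ_X` in `b = ℓ_X b`, and
apply the sign rule for sums over sign conditions to each term. -/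
lemma coeff_antipode_smul {z : W} (hz : ∀ x : Face W, (z • x).sign = -x.sign) (hXY : X ≤ Y)
    (a : MonoidAlgebra k (Face W)) {y : Face W} (hy : y.flat = Y) :
    (ℓ.idem X * a * ℓ.idem Y).coeff y =
      (-1) ^ (Module.finrank ℝ Y.1 - Module.finrank ℝ X.1) *
        (ℓ.idem X * a * ℓ.idem Y).coeff (z • y) := by
  classical
  let _ := Fintype.ofFinite (Face W)
  set b := ℓ.idem X * a * ℓ.idem Y with hbdef
  have hb : b ∈ faceSpan k fun x ↦ Y ≤ x.flat := ℓ.mul_idem_mem_faceSpan Y _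
  have hX : ∀ w : Face W, ¬ w.flat ≤ X → MonoidAlgebra.single w 1 * b = 0 := fun w hw ↦ by
    rw [hbdef, ← mul_assoc, ← mul_assoc, ℓ.mul_idem_eq_zero (single_mem_faceSpan hw), zero_mul,
      zero_mul]
  have hexp : ∀ y, b.coeff y =
      ∑ x, (ℓ.ell X).coeff x * (MonoidAlgebra.single x (1 : k) * b).coeff y := by
    intro y
    have h1 : b = ∑ x, (ℓ.ell X).coeff x • (MonoidAlgebra.single x (1 : k) * b) := by
      simp only [← smul_mul_assoc]
      rw [← Finset.sum_mul, ← eq_sum_smul_single, hbdef, ← mul_assoc, ← mul_assoc, ℓ.ell_mul_idem]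
    conv_lhs => rw [h1, ← coeffAt_apply, map_sum]
    rfl
  have hell : ∀ x, (ℓ.ell X).coeff (z • x) = (ℓ.ell X).coeff x := fun x ↦ by
    conv_lhs => rw [← antipode_smul_flat hz X, ← ℓ.act_ell, coeff_act]
  rw [hexp, hexp, Finset.mul_sum]
  refine Fintype.sum_equiv (MulAction.toPerm z) _ _ fun x ↦ ?_
  rw [MulAction.toPerm_apply, hell]
  by_cases hx0 : (ℓ.ell X).coeff x = 0
  · simp [hx0]
  have hx := ℓ.supp_eq X x hx0
  have hzx : (z • x).flat = X := by rw [Face.flat_smul, hx, antipode_smul_flat hz]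
  have hzy : (z • y).flat = Y := by rw [Face.flat_smul, hy, antipode_smul_flat hz]
  rw [coeff_single_mul hx hy hb, coeff_single_mul hzx hzy hb, ← smul_mul',
    (MulAction.injective z).eq_iff, hz]
  split_ifs
  · rw [faceSignSum_between_neg hXY hb hX fun H hH ↦ ?_]
    · ring
    · rw [Ne, Face.sign_eq_zero_iff, hy]
      exact (mem_between.1 hH).2
  · simp

/-- The antipodal map acts on `e_X kℱ e_Y` by the sign `(-1) ^ (dim Y - dim X)`. -/
lemma act_antipode {z : W} (hz : ∀ x : Face W, (z • x).sign = -x.sign) (hXY : X ≤ Y)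
    (a : MonoidAlgebra k (Face W)) :
    act k z (ℓ.idem X * a * ℓ.idem Y) =
      (-1 : k) ^ (Module.finrank ℝ Y.1 - Module.finrank ℝ X.1) • (ℓ.idem X * a * ℓ.idem Y) := by
  set s : k := (-1) ^ (Module.finrank ℝ Y.1 - Module.finrank ℝ X.1) with hs
  have h1 : act k z (ℓ.idem X * a * ℓ.idem Y) - s • (ℓ.idem X * a * ℓ.idem Y) =
      (ℓ.idem X * act k z a - s • (ℓ.idem X * a)) * ℓ.idem Y := by
    rw [map_mul, map_mul, ℓ.act_idem, ℓ.act_idem, antipode_smul_flat hz, antipode_smul_flat hz,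
      sub_mul, smul_mul_assoc]
  rw [← sub_eq_zero, h1]
  refine ℓ.mul_idem_eq_zero_of_coeff fun y hy ↦ ?_
  rw [← h1, ← coeffAt_apply, map_sub, map_smul, coeffAt_apply, coeffAt_apply, smul_eq_mul,
    sub_eq_zero, ℓ.coeff_antipode_smul hz hXY a hy]
  conv_lhs => rw [← antipode_smul_smul hz y]
  rw [coeff_act, ← mul_assoc, ← hs]
  simp [hs, ← mul_pow]

lemma idem_mul_mul_idem_eq_zero (h : ¬ X ≤ Y) (a : MonoidAlgebra k (Face W)) :
    ℓ.idem X * a * ℓ.idem Y = 0 :=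
  ℓ.mul_idem_eq_zero <| mul_mem_faceSpan (ℓ.idem_mem X) (mem_faceSpan_true a) fun x y hx _ hxy ↦
    h ((hx.trans (Face.flat_le_mul_left x y)).trans hxy)

end EllFamily

/-! ### Ranks and arrows -/

lemma Flat.center_le (X : Flat W) : (sInf (arrangement W) : Submodule ℝ V) ≤ X.1 := fun _ hv ↦
  Flat.mem_of_forall fun H _ ↦ Submodule.mem_sInf.1 hv H H.2

lemma Flat.rank_add (X : Flat W) :
    X.rank + Module.finrank ℝ (sInf (arrangement W) : Submodule ℝ V) = Module.finrank ℝ X.1 :=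
  Nat.sub_add_cancel (Submodule.finrank_mono X.center_le)

/-- The antipodal map fixes the elements of `ε_P A ε_Q`, and it negates them if the ranks of `P` and
`Q` differ by an odd number. -/
lemma EllFamily.orbitIdem_mul_mul_orbitIdem (ℓ : EllFamily k W) {z : W}
    (hz : ∀ x : Face W, (z • x).sign = -x.sign) (h2 : (2 : k) ≠ 0) {P Q : Orbit W}
    (hodd : Odd ((Q.rank : ℤ) - (P.rank : ℤ))) (a : invariants k W) :
    ℓ.orbitIdem P * a * ℓ.orbitIdem Q = 0 := by
  classical
  let _ := Fintype.ofFinite (Flat W)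
  have hval : ((ℓ.orbitIdem P * a * ℓ.orbitIdem Q : invariants k W) : MonoidAlgebra k (Face W)) =
      ∑ X : {X : Flat W // X.orbit = P}, ∑ Y : {Y : Flat W // Y.orbit = Q},
        ℓ.idem X.1 * a * ℓ.idem Y.1 := by
    simp only [orbitIdem, MulMemClass.coe_mul, Finset.sum_mul, Finset.mul_sum]
    rw [Finset.sum_comm]
  have hinv := mem_invariants.1 (ℓ.orbitIdem P * a * ℓ.orbitIdem Q).2 z
  have hneg : act k z (ℓ.orbitIdem P * a * ℓ.orbitIdem Q : invariants k W).1 =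
      -(ℓ.orbitIdem P * a * ℓ.orbitIdem Q : invariants k W).1 := by
    rw [hval, map_sum, ← Finset.sum_neg_distrib]
    refine Finset.sum_congr rfl fun X _ ↦ ?_
    rw [map_sum, ← Finset.sum_neg_distrib]
    refine Finset.sum_congr rfl fun Y _ ↦ ?_
    by_cases hXY : X.1 ≤ Y.1
    · have hle := Submodule.finrank_mono (show X.1.1 ≤ Y.1.1 from hXY)
      have hX := X.1.rank_add
      have hY := Y.1.rank_add
      have hd : Odd (Module.finrank ℝ Y.1.1 - Module.finrank ℝ X.1.1) := by
        rw [← X.2, ← Y.2, Orbit.rank_orbit, Orbit.rank_orbit] at hodd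
        have h3 : (Y.1.rank : ℤ) - X.1.rank =
            ((Module.finrank ℝ Y.1.1 - Module.finrank ℝ X.1.1 : ℕ) : ℤ) := by omega
        rw [h3] at hodd
        exact_mod_cast hodd
      rw [ℓ.act_antipode hz hXY, hd.neg_one_pow, neg_one_smul]
    · rw [ℓ.idem_mul_mul_idem_eq_zero hXY, map_zero, neg_zero]
  rw [hneg] at hinv
  refine Subtype.ext ?_
  have h4 : (2 : k) • (ℓ.orbitIdem P * a * ℓ.orbitIdem Q : invariants k W).1 = 0 := by
    rw [two_smul]
    nth_rewrite 1 [← hinv]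
    exact neg_add_cancel _
  exact (smul_eq_zero.1 h4).resolve_left h2

lemma numArrows_eq_zero {A : Type*} [Ring A] [Algebra k A] {e f : A} (h : ∀ a, f * a * e = 0) :
    numArrows k e f = 0 := by
  have h1 : LinearMap.mulLeft k f ∘ₗ LinearMap.mulRight k e = 0 :=
    LinearMap.ext fun a ↦ by simp [← mul_assoc, h]
  have h2 : Submodule.map (0 : A →ₗ[k] A) (Submodule.restrictScalars k (Ring.jacobson A)) = ⊥ :=
    Submodule.map_zero _
  rw [numArrows, h1, h2, Submodule.map_bot, rank_bot]

/-- Covering orbits differ by one in rank. -/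
lemma Orbit.rank_of_covBy {P Q : Orbit W} (h : P ⋖ Q) : Q.rank = P.rank + 1 := by
  obtain ⟨X, Y, rfl, rfl, hXY⟩ := h.le
  have hne : X < Y := lt_of_le_of_ne hXY fun he ↦ h.lt.ne (congrArg Flat.orbit he)
  obtain ⟨Z, ⟨hXZ, hZY⟩, hmin⟩ := (Set.toFinite {Z : Flat W | X < Z ∧ Z ≤ Y}).exists_minimal
    ⟨Y, hne, le_rfl⟩
  have hnotle : ¬ Z ≤ X := not_le_of_gt hXZ
  rw [Flat.le_iff] at hnotle
  push Not at hnotle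
  obtain ⟨H, hXH, hZH⟩ := hnotle
  obtain ⟨T, hT⟩ := Flat.exists_eq_sInf ({K | Z.1 ≤ (K : Submodule ℝ V)} ∪ {H})
  have hTmem : T.1 = Z.1 ⊓ (H : Submodule ℝ V) := by
    ext v
    rw [hT, Submodule.mem_inf]
    exact ⟨fun hv ↦ ⟨Flat.mem_of_forall fun K hK ↦ hv K (Or.inl hK), hv H (Or.inr rfl)⟩,
      fun hv K hK ↦ hK.elim (fun hK ↦ hK hv.1) fun hK ↦ hK ▸ hv.2⟩
  have hXT : X.1 ≤ T.1 := hTmem ▸ le_inf hXZ.le hXH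
  have hTZ : T.1 ≤ Z.1 := hTmem ▸ inf_le_left
  have hTX : T.1 = X.1 := by
    by_contra hne'
    have hlt : X < T := lt_of_le_of_ne hXT fun he ↦ hne' (congrArg Subtype.val he).symm
    have hZT : Z.1 ≤ T.1 := hmin ⟨hlt, le_trans hTZ hZY⟩ hTZ
    exact hZH (hZT.trans (hTmem ▸ inf_le_right))
  have hdim : Module.finrank ℝ Z.1 ≤ Module.finrank ℝ X.1 + 1 := by
    have h1 := Submodule.finrank_sup_add_finrank_inf_eq Z.1 (H : Submodule ℝ V)
    have h3 := Submodule.finrank_add_finrank_orthogonal (ℝ ∙ normal H)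
    rw [finrank_span_singleton (normal_ne_zero H), ← eq_normal_orthogonal] at h3
    have h4 := Submodule.finrank_le (Z.1 ⊔ (H : Submodule ℝ V))
    rw [← hTmem, hTX] at h1
    omega
  have hlt : Module.finrank ℝ X.1 < Module.finrank ℝ Z.1 :=
    Submodule.finrank_lt_finrank_of_lt (show X.1 < Z.1 from hXZ)
  have hX := X.rank_add
  have hZ := Z.rank_add
  have hZQ : Z.orbit = Y.orbit := by
    by_contra hne'
    refine h.2 (c := Z.orbit) (lt_of_le_of_ne ⟨X, Z, rfl, rfl, hXZ.le⟩ fun he ↦ ?_)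
      (lt_of_le_of_ne ⟨Z, Y, rfl, rfl, hZY⟩ hne')
    have := congrArg Orbit.rank he
    rw [Orbit.rank_orbit, Orbit.rank_orbit] at this
    omega
  rw [← hZQ, Orbit.rank_orbit, Orbit.rank_orbit]
  omega

end FaceQuiver

namespace FaceQuiver

variable {V : Type*} [NormedAddCommGroup V] [InnerProductSpace ℝ V] [FiniteDimensional ℝ V]

/-! ### The walls of a chamber -/

section Cone

variable {ι : Type*} [Finite ι]

/-- Finitely many open half spaces with a common point: a hyperplane whose half space cannot be
left out meets the closure of the intersection in a spanning set. A vector on all these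
hyperplanes lies on every one of the given hyperplanes. -/
lemma mem_ker_of_forall_wall (f : ι → V →ₗ[ℝ] ℝ) {p : V} (hp : ∀ i, 0 < f i p) {v : V}
    (hv : ∀ i, Submodule.span ℝ ((LinearMap.ker (f i) : Set V) ∩ closure {x | ∀ j, 0 < f j x}) =
      LinearMap.ker (f i) → f i v = 0) (i : ι) : f i v = 0 := by
  classical
  set C : Set V := {x | ∀ j, 0 < f j x} with hC
  obtain ⟨S, hS, hmin⟩ := (Set.toFinite {S : Set ι | {x | ∀ j ∈ S, 0 < f j x} ⊆ C}).exists_minimal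
    ⟨Set.univ, fun x hx j ↦ hx j trivial⟩
  have hwall : ∀ h ∈ S, Submodule.span ℝ ((LinearMap.ker (f h) : Set V) ∩ closure C) =
      LinearMap.ker (f h) := by
    intro h hh
    refine le_antisymm (Submodule.span_le.2 Set.inter_subset_left) fun y hy ↦ ?_
    have hy : f h y = 0 := hy
    -- by minimality, some point on the other side of `h` satisfies the remaining conditions
    have hex : ∃ u, (∀ j ∈ S, j ≠ h → 0 < f j u) ∧ u ∉ C := by
      by_contra! hcon
      have hle : S ⊆ S \ {h} := hmin (fun u hu ↦ hcon u fun j hj hjh ↦ hu j ⟨hj, hjh⟩)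
        Set.sdiff_subset
      exact (hle hh).2 rfl
    obtain ⟨u, hu, huC⟩ := hex
    have hhu : f h u ≤ 0 := by
      by_contra! hpos
      refine huC (hS fun j hj ↦ ?_)
      by_cases hjh : j = h
      · rw [hjh]; exact hpos
      · exact hu j hj hjh
    -- the point where the segment from `p` to `u` crosses the hyperplane, up to a scalar
    set q : V := f h p • u - f h u • p with hq
    have hq0 : f h q = 0 := by simp [hq]; ring
    have hqpos : ∀ j ∈ S, j ≠ h → 0 < f j q := fun j hj hjh ↦ by
      have h1 := mul_pos (hp h) (hu j hj hjh)
      have h2 := mul_nonneg (neg_nonneg.2 hhu) (hp j).le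
      simp only [hq, map_sub, map_smul, smul_eq_mul]
      linarith
    have hmem : ∀ x, f h x = 0 → (∀ j ∈ S, j ≠ h → 0 < f j x) →
        x ∈ Submodule.span ℝ ((LinearMap.ker (f h) : Set V) ∩ closure C) := by
      intro x hx hx'
      refine Submodule.subset_span ⟨hx, ?_⟩
      have hcont : Continuous fun t : ℝ ↦ x + t • p := by fun_prop
      have ht : Filter.Tendsto (fun t : ℝ ↦ x + t • p) (nhdsWithin 0 (Set.Ioi 0)) (nhds x) := by
        simpa using (hcont.tendsto 0).mono_left nhdsWithin_le_nhds
      refine mem_closure_of_tendsto ht ?_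
      filter_upwards [self_mem_nhdsWithin] with t ht
      have ht : (0 : ℝ) < t := ht
      refine hS fun j hj ↦ ?_
      have h1 := mul_pos ht (hp j)
      simp only [map_add, map_smul, smul_eq_mul]
      by_cases hjh : j = h
      · rw [hjh] at h1 ⊢; rw [hx]; linarith
      · linarith [hx' j hj hjh]
    have hev : ∀ᶠ t : ℝ in nhdsWithin 0 (Set.Ioi 0), ∀ j : ι, j ∈ S → j ≠ h →
        0 < f j (q + t • y) := by
      rw [Filter.eventually_all]
      intro j
      by_cases hj : j ∈ S ∧ j ≠ h
      · have hcont : Continuous fun t : ℝ ↦ f j (q + t • y) := by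
          simp only [map_add, map_smul, smul_eq_mul]
          fun_prop
        have ht := (hcont.tendsto 0).mono_left (nhdsWithin_le_nhds (s := Set.Ioi 0))
        simp only [zero_smul, add_zero] at ht
        filter_upwards [ht.eventually (lt_mem_nhds (hqpos j hj.1 hj.2))] with t ht _ _ using ht
      · exact Filter.Eventually.of_forall fun t h1 h2 ↦ absurd ⟨h1, h2⟩ hj
    obtain ⟨t, ht, htpos⟩ := (hev.and self_mem_nhdsWithin).exists
    have htpos : (0 : ℝ) < t := htpos
    have h1 := Submodule.sub_mem _ (hmem (q + t • y) (by simp [hq0, hy]) ht) (hmem q hq0 hqpos)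
    rw [add_sub_cancel_left] at h1
    simpa [htpos.ne'] using Submodule.smul_mem _ t⁻¹ h1
  -- `C` is invariant under translations by multiples of `v`
  by_contra hne
  have h2 : p + (-(f i p / f i v)) • v ∈ C := hS fun j hj ↦ by
    simpa [hv j (hwall j hj)] using hp j
  have h3 := h2 i
  simp only [map_add, map_smul, smul_eq_mul] at h3
  have : -(f i p / f i v) * f i v = - f i p := by field_simp
  linarith

end Cone

variable {W : Subgroup (V ≃ₗᵢ[ℝ] V)}

lemma side_ne_zero_of_notMem {v : V} (hv : v ∈ (hyperplaneUnion W)ᶜ) (H : arrangement W) :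
    side H v ≠ 0 := fun h ↦ hv (Set.mem_iUnion₂.2 ⟨H, H.2, (side_eq_zero H v).1 h⟩)

/-- The functional that defines `H`, oriented so as to be positive at `v₀`. -/
def orientedNormal (v₀ : V) (H : arrangement W) : V →ₗ[ℝ] ℝ :=
  inner ℝ (normal H) v₀ • innerₛₗ ℝ (normal H)

lemma orientedNormal_apply (v₀ : V) (H : arrangement W) (v : V) :
    orientedNormal v₀ H v = inner ℝ (normal H) v₀ * inner ℝ (normal H) v := rfl

/-- A chamber is the intersection of the open half spaces that contain one of its points. -/
lemma chamber_eq {v₀ : V} (hv₀ : v₀ ∈ (hyperplaneUnion W)ᶜ) :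
    connectedComponentIn (hyperplaneUnion W)ᶜ v₀ =
      {v | ∀ H : arrangement W, 0 < orientedNormal v₀ H v} := by
  have hne : ∀ H : arrangement W, inner ℝ (normal H) v₀ ≠ 0 := fun H h ↦
    side_ne_zero_of_notMem hv₀ H (by rw [side, h, sign_zero])
  refine Set.Subset.antisymm (fun v hv H ↦ ?_) (IsPreconnected.subset_connectedComponentIn ?_ ?_ ?_)
  · have hpre := (isPreconnected_connectedComponentIn (F := (hyperplaneUnion W)ᶜ) (x := v₀)).image
      (orientedNormal v₀ H) (LinearMap.continuous_of_finiteDimensional _).continuousOn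
    have h1 : orientedNormal v₀ H v₀ ∈ orientedNormal v₀ H ''
        connectedComponentIn (hyperplaneUnion W)ᶜ v₀ := ⟨v₀, mem_connectedComponentIn hv₀, rfl⟩
    by_contra! hle
    obtain ⟨u, hu, hu0⟩ := hpre.ordConnected.out ⟨v, hv, rfl⟩ h1
      ⟨hle, (mul_self_pos.2 (hne H)).le⟩
    have h2 := side_ne_zero_of_notMem (connectedComponentIn_subset _ _ hu) H
    rw [side, Ne, sign_eq_zero_iff] at h2
    exact mul_ne_zero (hne H) h2 hu0
  · refine Convex.isPreconnected ?_
    rw [Set.ofPred_forall]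
    exact convex_iInter fun H ↦ convex_halfSpace_gt (orientedNormal v₀ H).isLinear 0
  · exact fun H ↦ mul_self_pos.2 (hne H)
  · intro v hv hvu
    obtain ⟨H, hH, hvH⟩ := Set.mem_iUnion₂.1 hvu
    have h3 := hv ⟨H, hH⟩
    have h4 := (side_eq_zero ⟨H, hH⟩ v).2 hvH
    rw [side, sign_eq_zero_iff] at h4
    rw [orientedNormal_apply, h4, mul_zero] at h3
    exact lt_irrefl _ h3

/-- The intersection of the walls of a chamber is the intersection of all the hyperplanes. -/
lemma mem_of_forall_wall [Finite W] {c : Set V} (hc : IsChamber W c) {v : V}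
    (hv : ∀ H ∈ walls W c, v ∈ H) : v ∈ (sInf (arrangement W) : Submodule ℝ V) := by
  obtain ⟨v₀, hv₀, rfl⟩ := hc
  have hne : ∀ H : arrangement W, inner ℝ (normal H) v₀ ≠ 0 := fun H h ↦
    side_ne_zero_of_notMem hv₀ H (by rw [side, h, sign_zero])
  have hker : ∀ H : arrangement W, LinearMap.ker (orientedNormal v₀ H) = (H : Submodule ℝ V) := by
    intro H
    ext u
    rw [LinearMap.mem_ker, orientedNormal_apply, mul_eq_zero, or_iff_right (hne H),
      ← sign_eq_zero_iff, ← side_eq_zero]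
    rfl
  refine Submodule.mem_sInf.2 fun H hH ↦ ?_
  have := mem_ker_of_forall_wall (orientedNormal v₀) (p := v₀) (fun H ↦ mul_self_pos.2 (hne H))
    (v := v) (fun H hH ↦ ?_) ⟨H, hH⟩
  · rwa [← LinearMap.mem_ker, hker] at this
  · rw [hker, ← chamber_eq hv₀] at hH
    rw [← LinearMap.mem_ker, hker]
    exact hv H ⟨H.2, hH⟩

/-! ### Roots -/

/-- The reflection in the hyperplane orthogonal to `v`. -/
def refl (v : V) : V ≃ₗᵢ[ℝ] V := (ℝ ∙ v)ᗮ.reflection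

lemma refl_apply (v x : V) : refl v x = x - (2 * inner ℝ v x / inner ℝ v v) • v := by
  rw [refl, Submodule.reflection_orthogonal_apply, Submodule.reflection_singleton_apply,
    real_inner_self_eq_norm_sq]
  simp only [neg_sub, RCLike.ofReal_real_eq_id, id]
  rw [two_smul, mul_div_assoc, two_mul, add_smul]

/-- A root of `W`: a non-zero vector, of any length, whose reflection lies in `W`. -/
def IsRoot (W : Subgroup (V ≃ₗᵢ[ℝ] V)) (v : V) : Prop := v ≠ 0 ∧ refl v ∈ W

lemma IsRoot.mem_arrangement {v : V} (hv : IsRoot W v) : (ℝ ∙ v)ᗮ ∈ arrangement W :=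
  ⟨⟨v, hv.1, rfl⟩, hv.2⟩

lemma refl_map (w : V ≃ₗᵢ[ℝ] V) (v : V) : refl (w v) = w * refl v * w⁻¹ := by
  have h : (mapSub w (ℝ ∙ v)ᗮ).reflection = w * (ℝ ∙ v)ᗮ.reflection * w⁻¹ :=
    Submodule.reflection_map w (ℝ ∙ v)ᗮ
  rwa [mapSub_hyperplane] at h

lemma IsRoot.map {v : V} (hv : IsRoot W v) {w : V ≃ₗᵢ[ℝ] V} (hw : w ∈ W) : IsRoot W (w v) :=
  ⟨by simpa using hv.1, by
    rw [refl_map]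
    exact W.mul_mem (W.mul_mem hw hv.2) (W.inv_mem hw)⟩

lemma IsRoot.refl {u v : V} (hv : IsRoot W v) (hu : IsRoot W u) : IsRoot W (refl u v) :=
  hv.map hu.2

lemma refl_smul {c : ℝ} (hc : c ≠ 0) (v : V) : refl (c • v) = refl v := by
  simp only [FaceQuiver.refl, Submodule.span_singleton_smul_eq hc.isUnit]

lemma IsRoot.smul {v : V} (hv : IsRoot W v) {c : ℝ} (hc : c ≠ 0) : IsRoot W (c • v) :=
  ⟨smul_ne_zero hc hv.1, by rw [refl_smul hc]; exact hv.2⟩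

lemma reflection_sup_orthogonal {K : Submodule ℝ V} {v : V} (hv : v ∈ Kᗮ) :
    (K ⊔ ℝ ∙ v)ᗮ.reflection = Kᗮ.reflection * refl v := by
  have hKv : (ℝ ∙ v) ≤ Kᗮ := (Submodule.span_singleton_le_iff_mem _ _).2 hv
  have hproj : ∀ x, (K ⊔ ℝ ∙ v).starProjection x =
      K.starProjection x + (ℝ ∙ v).starProjection x := by
    intro x
    refine Submodule.eq_starProjection_of_mem_orthogonal
      (Submodule.add_mem_sup (K.starProjection_apply_mem x) ((ℝ ∙ v).starProjection_apply_mem x)) ?_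
    rw [← Submodule.inf_orthogonal]
    constructor
    · rw [← sub_sub]
      exact Submodule.sub_mem _ (K.sub_starProjection_mem_orthogonal x)
        (hKv ((ℝ ∙ v).starProjection_apply_mem x))
    · rw [add_comm, ← sub_sub]
      refine Submodule.sub_mem _ ((ℝ ∙ v).sub_starProjection_mem_orthogonal x) ?_
      exact Submodule.orthogonal_le hKv (K.le_orthogonal_orthogonal (K.starProjection_apply_mem x))
  have hzero : ∀ x, K.starProjection ((ℝ ∙ v).starProjection x) = 0 := fun x ↦
    (Submodule.starProjection_apply_eq_zero_iff K).2 (hKv ((ℝ ∙ v).starProjection_apply_mem x))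
  ext x
  have hr : ∀ (L : Submodule ℝ V) (y : V), Lᗮ.reflection y = y - (2 : ℝ) • L.starProjection y := by
    intro L y
    rw [Submodule.reflection_orthogonal_apply, Submodule.reflection_apply, neg_sub, two_smul,
      two_smul]
  change _ = Kᗮ.reflection ((ℝ ∙ v)ᗮ.reflection x)
  rw [hr, hr, hr, hproj, map_sub, map_smul, hzero]
  module

/-- If `W` has pairwise orthogonal roots, then `W` contains the map that is `-1` on their span and
the identity on the orthogonal complement. -/
lemma reflection_span_orthogonal_mem {ι : Type*} (β : ι → V) (hβ : ∀ i, IsRoot W (β i))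
    (ho : Pairwise fun i j ↦ inner ℝ (β i) (β j) = 0) (s : Finset ι) :
    (Submodule.span ℝ (β '' s))ᗮ.reflection ∈ W := by
  classical
  induction s using Finset.induction_on with
  | empty =>
    have : (⊤ : Submodule ℝ V).reflection = 1 := by
      ext x
      exact Submodule.reflection_mem_subspace_eq_self trivial
    simp only [Finset.coe_empty, Set.image_empty, Submodule.span_empty,
      Submodule.bot_orthogonal_eq_top, this]
    exact W.one_mem
  | insert i s hi ih =>
    have h : Submodule.span ℝ (β '' (insert i s : Finset ι)) =
        Submodule.span ℝ (β '' s) ⊔ ℝ ∙ β i := by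
      rw [Finset.coe_insert, Set.image_insert_eq, Submodule.span_insert, sup_comm]
    have hmem : β i ∈ (Submodule.span ℝ (β '' s))ᗮ := by
      rw [Submodule.mem_orthogonal']
      intro u hu
      induction hu using Submodule.span_induction with
      | mem u hu =>
        obtain ⟨j, hj, rfl⟩ := hu
        exact ho fun hij ↦ hi (hij ▸ hj)
      | zero => simp
      | add u u' _ _ h h' => rw [inner_add_right, h, h', add_zero]
      | smul c u _ h => rw [inner_smul_right, h, mul_zero]
    simp only [h]
    rw [reflection_sup_orthogonal hmem]
    exact W.mul_mem ih (hβ i).2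

/-- If a chamber has `r` walls and `W` has `r` pairwise orthogonal roots, then the reflection in
the intersection of all hyperplanes lies in `W`. -/
lemma reflection_center_mem [Finite W] {c : Set V} (hc : IsChamber W c) {ι : Type*} [Fintype ι]
    (e : ι ≃ walls W c) (β : ι → V) (hβ : ∀ i, IsRoot W (β i))
    (ho : Pairwise fun i j ↦ inner ℝ (β i) (β j) = 0) :
    (sInf (arrangement W) : Submodule ℝ V).reflection ∈ W := by
  classical
  set C : Submodule ℝ V := sInf (arrangement W) with hC
  choose n hn0 hn using fun i ↦ (e i).2.1.1
  have hle : Cᗮ ≤ Submodule.span ℝ (Set.range n) := by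
    rw [← Submodule.orthogonal_orthogonal (Submodule.span ℝ (Set.range n))]
    refine Submodule.orthogonal_le fun v hv ↦ mem_of_forall_wall hc fun H hH ↦ ?_
    have h1 := hn (e.symm ⟨H, hH⟩)
    rw [e.apply_symm_apply] at h1
    change H = _ at h1
    rw [h1, Submodule.mem_orthogonal_singleton_iff_inner_right]
    exact hv _ (Submodule.subset_span ⟨_, rfl⟩)
  have hli : LinearIndependent ℝ β := linearIndependent_of_ne_zero_of_inner_eq_zero
    (fun i ↦ (hβ i).1) ho
  have hβC : Submodule.span ℝ (Set.range β) ≤ Cᗮ := by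
    refine Submodule.span_le.2 ?_
    rintro _ ⟨i, rfl⟩
    have h1 : C ≤ (ℝ ∙ β i)ᗮ := sInf_le (hβ i).mem_arrangement
    have h2 := Submodule.orthogonal_le h1
    rw [Submodule.orthogonal_orthogonal] at h2
    exact h2 (Submodule.mem_span_singleton_self _)
  have heq : Submodule.span ℝ (Set.range β) = Cᗮ := by
    refine Submodule.eq_of_le_of_finrank_le hβC ?_
    rw [finrank_span_eq_card hli]
    exact (Submodule.finrank_mono hle).trans (finrank_range_le_card n)
  have h := reflection_span_orthogonal_mem β hβ ho Finset.univ
  simp only [Finset.coe_univ, Set.image_univ, heq, Submodule.orthogonal_orthogonal] at h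
  exact h

/-! ### The antipodal map -/

/-- The reflection in the intersection of all hyperplanes negates all normal vectors, so it maps
each face to its opposite. -/
lemma antipode_sign [Finite W] (hC : (sInf (arrangement W) : Submodule ℝ V).reflection ∈ W)
    (x : Face W) : ((⟨_, hC⟩ : W) • x).sign = -x.sign := by
  obtain ⟨v, hv⟩ := x.nonempty
  have hv' : (sInf (arrangement W) : Submodule ℝ V).reflection v ∈
    ((⟨_, hC⟩ : W) • x).carrier := ⟨v, hv, rfl⟩
  funext H
  have hn : normal H ∈ (sInf (arrangement W) : Submodule ℝ V)ᗮ := by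
    have h1 : (sInf (arrangement W) : Submodule ℝ V) ≤ (H : Submodule ℝ V) := sInf_le H.2
    rw [eq_normal_orthogonal] at h1
    have h2 := Submodule.orthogonal_le h1
    rw [Submodule.orthogonal_orthogonal] at h2
    exact h2 (Submodule.mem_span_singleton_self _)
  rw [← Face.mem_iff _ |>.1 hv' H, Pi.neg_apply, ← x.mem_iff.1 hv H, side, side, ← Left.sign_neg,
    ← inner_neg_left]
  congr 1
  rw [← LinearIsometryEquiv.inner_map_map (sInf (arrangement W) : Submodule ℝ V).reflection
    (-normal H) v, map_neg, Submodule.reflection_mem_subspace_orthogonalComplement_eq_neg hn,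
    neg_neg]

/-- If the reflection in the intersection of all hyperplanes belongs to `W`, then there are no
arrows between orbits whose ranks differ by an odd number. An odd difference forces this reflection
to be non-trivial, hence of order two, so that the characteristic of `k` is not two. -/
theorem arrows_eq_zero [Finite W] {k : Type*} [Field k] (hk : (Nat.card W : k) ≠ 0)
    (ℓ : EllFamily k W) (hC : (sInf (arrangement W) : Submodule ℝ V).reflection ∈ W)
    {P Q : Orbit W} (hodd : Odd ((Q.rank : ℤ) - (P.rank : ℤ))) : ℓ.arrows Q P = 0 := by
  refine numArrows_eq_zero (ℓ.orbitIdem_mul_mul_orbitIdem (antipode_sign hC) (fun h2 ↦ ?_) hodd)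
  by_cases hz : (⟨_, hC⟩ : W) = 1
  · -- the arrangement is empty
    have htop : (sInf (arrangement W) : Submodule ℝ V) = ⊤ := by
      refine eq_top_iff.2 fun v _ ↦ ?_
      rw [← Submodule.reflection_eq_self_iff]
      exact DFunLike.congr_fun (congrArg Subtype.val hz) v
    have hrank : ∀ X : Flat W, X.rank = 0 := fun X ↦ by
      rw [Flat.rank, htop, finrank_top]
      exact Nat.sub_eq_zero_of_le (Submodule.finrank_le _)
    obtain ⟨X, rfl⟩ := Quotient.exists_rep P
    obtain ⟨Y, rfl⟩ := Quotient.exists_rep Q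
    change Odd ((Y.rank : ℤ) - (X.rank : ℤ)) at hodd
    simp [hrank] at hodd
  · have hord : orderOf (⟨_, hC⟩ : W) = 2 := orderOf_eq_prime
      (Subtype.ext (by
        rw [pow_two]
        exact Submodule.reflection_mul_reflection _)) hz
    obtain ⟨m, hm⟩ := hord ▸ orderOf_dvd_natCard (⟨_, hC⟩ : W)
    refine hk ?_
    rw [hm, Nat.cast_mul, Nat.cast_two, h2, zero_mul]

/-! ### The order of a product of two reflections -/

section Order

variable {a b : V}

lemma refl_apply_of_unit (ha : inner ℝ a a = (1 : ℝ)) (x : V) :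
    refl a x = x - (2 * inner ℝ a x : ℝ) • a := by
  rw [refl_apply, ha, div_one]

/-- A product of two reflections in the basis formed by the two unit normal vectors. -/
lemma refl_mul_refl_apply (ha : inner ℝ a a = (1 : ℝ)) (hb : inner ℝ b b = (1 : ℝ)) {x : ℝ}
    (hx : 2 * inner ℝ a b = x) (p q : ℝ) :
    (refl a * refl b) (p • a + q • b) = (p * (x ^ 2 - 1) + q * x) • a + (-(p * x) - q) • b := by
  change refl a (refl b (p • a + q • b)) = _
  rw [refl_apply_of_unit hb, refl_apply_of_unit ha]
  simp only [inner_add_right, inner_sub_right, inner_smul_right, ha, hb, real_inner_comm a b]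
  rw [show inner ℝ a b = x / 2 by linarith]
  module

lemma coeffs_eq_zero (ha : inner ℝ a a = (1 : ℝ)) (hb : inner ℝ b b = (1 : ℝ)) {x : ℝ}
    (hx : 2 * inner ℝ a b = x) (hx4 : x ^ 2 ≠ 4) {p q : ℝ} (h : p • a + q • b = 0) :
    p = 0 ∧ q = 0 := by
  have h1 : inner ℝ a (p • a + q • b) = (0 : ℝ) := by rw [h, inner_zero_right]
  have h2 : inner ℝ b (p • a + q • b) = (0 : ℝ) := by rw [h, inner_zero_right]
  simp only [inner_add_right, inner_smul_right, ha, hb, real_inner_comm a b] at h1 h2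
  rw [show inner ℝ a b = x / 2 by linarith] at h1 h2
  have h3 : p * (x ^ 2 - 4) = 0 := by linear_combination 2 * x * h2 - 4 * h1
  have hp : p = 0 := (mul_eq_zero.1 h3).resolve_right (sub_ne_zero.2 hx4)
  subst hp
  exact ⟨rfl, by linarith⟩

lemma sq_ne_four (ha : inner ℝ a a = (1 : ℝ)) (hb : inner ℝ b b = (1 : ℝ)) {x : ℝ}
    (hx : 2 * inner ℝ a b = x) (h : refl a * refl b ≠ 1) : x ^ 2 ≠ 4 := by
  intro h4
  have h1 : inner ℝ (b - (x / 2) • a) (b - (x / 2) • a) = (0 : ℝ) := by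
    simp only [inner_sub_left, inner_sub_right, inner_smul_left, inner_smul_right, ha, hb,
      real_inner_comm a b, RCLike.conj_to_real]
    rw [show inner ℝ a b = x / 2 by linarith]
    linarith
  have h2 : b = (x / 2) • a := sub_eq_zero.1 (inner_self_eq_zero.1 h1)
  have hx0 : x / 2 ≠ 0 := by
    intro h0
    rw [show x = 0 by linarith] at h4
    norm_num at h4
  refine h ?_
  rw [h2, refl_smul hx0]
  exact Submodule.reflection_mul_reflection _

/-- The coefficients of `(s_a s_b) ^ m` applied to `b`. -/
def rotCoeff (x : ℝ) : ℕ → ℝ × ℝ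
  | 0 => (0, 1)
  | m + 1 => ((rotCoeff x m).1 * (x ^ 2 - 1) + (rotCoeff x m).2 * x,
      -((rotCoeff x m).1 * x) - (rotCoeff x m).2)

lemma pow_apply (ha : inner ℝ a a = (1 : ℝ)) (hb : inner ℝ b b = (1 : ℝ)) {x : ℝ}
    (hx : 2 * inner ℝ a b = x) (m : ℕ) :
    ((refl a * refl b) ^ m) b = (rotCoeff x m).1 • a + (rotCoeff x m).2 • b := by
  induction m with
  | zero => simp [rotCoeff]
  | succ m ih =>
    rw [pow_succ']
    change (refl a * refl b) (((refl a * refl b) ^ m) b) = _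
    rw [ih, refl_mul_refl_apply ha hb hx, rotCoeff]

/-- The equations that the cosine of the angle between two walls satisfies. -/
lemma rotCoeff_orderOf (ha : inner ℝ a a = (1 : ℝ)) (hb : inner ℝ b b = (1 : ℝ)) {x : ℝ}
    (hx : 2 * inner ℝ a b = x) {m : ℕ} (hm : orderOf (refl a * refl b) = m) (hm1 : m ≠ 1) :
    (rotCoeff x m).1 = 0 ∧ (rotCoeff x m).2 = 1 := by
  have h1 : refl a * refl b ≠ 1 := fun h ↦ hm1 (by rw [← hm, h, orderOf_one])
  have h2 := pow_apply ha hb hx m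
  rw [← hm, pow_orderOf_eq_one, hm] at h2
  have h3 : (rotCoeff x m).1 • a + ((rotCoeff x m).2 - 1) • b = 0 := by
    rw [sub_smul, one_smul, ← add_sub_assoc, ← h2]
    exact sub_self b
  obtain ⟨h4, h5⟩ := coeffs_eq_zero ha hb hx (sq_ne_four ha hb hx h1) h3
  exact ⟨h4, by linarith⟩

lemma inner_eq_zero_of_orderOf (ha : inner ℝ a a = (1 : ℝ)) (hb : inner ℝ b b = (1 : ℝ))
    (h : orderOf (refl a * refl b) = 2) : inner ℝ a b = (0 : ℝ) := by
  obtain ⟨-, h2⟩ := rotCoeff_orderOf ha hb rfl h (by norm_num)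
  simp only [rotCoeff] at h2
  nlinarith

lemma mul_refl_sq_of_inner_eq_zero (ha : inner ℝ a a = (1 : ℝ)) (hb : inner ℝ b b = (1 : ℝ))
    (h : inner ℝ a b = (0 : ℝ)) : (refl a * refl b) ^ 2 = 1 := by
  ext x
  rw [pow_two]
  change refl a (refl b (refl a (refl b x))) = x
  simp only [refl_apply_of_unit ha, refl_apply_of_unit hb, inner_sub_right, inner_smul_right, ha,
    hb, h, real_inner_comm a b]
  module

lemma four_inner_sq_of_orderOf (ha : inner ℝ a a = (1 : ℝ)) (hb : inner ℝ b b = (1 : ℝ))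
    (h : orderOf (refl a * refl b) = 3) : 4 * inner ℝ a b ^ 2 = (1 : ℝ) := by
  obtain ⟨h1, h2⟩ := rotCoeff_orderOf ha hb rfl h (by norm_num)
  set x : ℝ := 2 * inner ℝ a b with hx
  rw [show 4 * inner ℝ a b ^ 2 = x ^ 2 by rw [hx]; ring]
  simp only [rotCoeff] at h1 h2
  have h3 : (x ^ 2 - 1) * (x ^ 2 - 2) = 0 := by linear_combination -h2
  have h4 : x * (x ^ 2 - 1) * (x ^ 2 - 3) = 0 := by linear_combination h1
  by_contra hne
  have hne : x ^ 2 - 1 ≠ 0 := sub_ne_zero.2 hne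
  have h5 := (mul_eq_zero.1 h3).resolve_left hne
  have h6 : x ≠ 0 := by rintro h0; rw [h0] at h5; norm_num at h5
  have h7 := (mul_eq_zero.1 h4).resolve_left (mul_ne_zero h6 hne)
  linarith

lemma two_inner_sq_of_orderOf (ha : inner ℝ a a = (1 : ℝ)) (hb : inner ℝ b b = (1 : ℝ))
    (h : orderOf (refl a * refl b) = 4) : 2 * inner ℝ a b ^ 2 = (1 : ℝ) := by
  obtain ⟨h1, h2⟩ := rotCoeff_orderOf ha hb rfl h (by norm_num)
  have h0 : inner ℝ a b ≠ (0 : ℝ) := fun h0 ↦ by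
    have := orderOf_le_of_pow_eq_one (by norm_num) (mul_refl_sq_of_inner_eq_zero ha hb h0)
    omega
  set x : ℝ := 2 * inner ℝ a b with hx
  have hx0 : x ≠ 0 := mul_ne_zero two_ne_zero h0
  rw [show 2 * inner ℝ a b ^ 2 = x ^ 2 / 2 by rw [hx]; ring]
  simp only [rotCoeff] at h1 h2
  have h3 : x * ((x ^ 2 - 2) * (x ^ 4 - 4 * x ^ 2 + 2)) = 0 := by linear_combination h1
  have h4 : x ^ 2 * ((x ^ 2 - 2) * (x ^ 2 - 3)) = 0 := by linear_combination -h2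
  have h3 := (mul_eq_zero.1 h3).resolve_left hx0
  have h4 := (mul_eq_zero.1 h4).resolve_left (pow_ne_zero 2 hx0)
  have : x ^ 2 - 2 = 0 := by linear_combination (x ^ 2 - 1) * h4 - h3
  linarith

lemma exists_golden_of_orderOf (ha : inner ℝ a a = (1 : ℝ)) (hb : inner ℝ b b = (1 : ℝ))
    (h : orderOf (refl a * refl b) = 5) :
    ∃ g : ℝ, g * g = g + 1 ∧ 4 * inner ℝ a b ^ 2 = g ^ 2 := by
  obtain ⟨h1, h2⟩ := rotCoeff_orderOf ha hb rfl h (by norm_num)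
  set x : ℝ := 2 * inner ℝ a b with hx
  rw [show 4 * inner ℝ a b ^ 2 = x ^ 2 by rw [hx]; ring]
  simp only [rotCoeff] at h1 h2
  have h3 : (x ^ 4 - 3 * x ^ 2 + 1) * (x ^ 4 - 4 * x ^ 2 + 2) = 0 := by linear_combination -h2
  have h4 : (x ^ 4 - 3 * x ^ 2 + 1) * (x * (x ^ 4 - 5 * x ^ 2 + 5)) = 0 := by
    linear_combination h1
  have h5 : (x * x - x - 1) * (x * x + x - 1) = 0 := by
    by_contra hne
    have hne : x ^ 4 - 3 * x ^ 2 + 1 ≠ 0 := fun h ↦ hne (by linear_combination h)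
    have h6 := (mul_eq_zero.1 h3).resolve_left hne
    rcases mul_eq_zero.1 ((mul_eq_zero.1 h4).resolve_left hne) with h7 | h7
    · rw [h7] at h6; norm_num at h6
    · have h8 : x ^ 2 = 3 := by linarith
      nlinarith
  rcases mul_eq_zero.1 h5 with h | h
  · exact ⟨x, by linarith, rfl⟩
  · exact ⟨-x, by linarith, by ring⟩

end Order

/-! ### Choosing simple roots with a given Gram matrix -/

/-- When the graph of `G` is a forest, signs can be adjusted one vertex at a time, in the order
given by `ρ`. -/
lemma exists_signs {r : ℕ} (v : Fin r → V) (G : Fin r → Fin r → ℝ) (hG : ∀ i j, G i j = G j i)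
    {ρ : Fin r → ℕ} (hρ : Function.Injective ρ)
    (hsq : ∀ i j, i ≠ j → inner ℝ (v i) (v j) ^ 2 = G i j ^ 2)
    (htree : ∀ i i' j, ρ i < ρ j → ρ i' < ρ j → G i j ≠ 0 → G i' j ≠ 0 → i = i') :
    ∃ s : Fin r → ℝ, (∀ i, s i ^ 2 = 1) ∧
      ∀ i j, i ≠ j → s i * s j * inner ℝ (v i) (v j) = G i j := by
  have key : ∀ m, ∃ s : Fin r → ℝ, (∀ i, s i ^ 2 = 1) ∧
      ∀ i j : Fin r, ρ i < ρ j → ρ j < m → s i * s j * inner ℝ (v i) (v j) = G i j := by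
    intro m
    induction m with
    | zero => exact ⟨fun _ ↦ 1, by simp, by simp⟩
    | succ m ih =>
      obtain ⟨s, hs, hsG⟩ := ih
      by_cases hl : ∃ l, ρ l = m
      swap
      · push Not at hl
        exact ⟨s, hs, fun i j hij hj ↦ hsG i j hij (lt_of_le_of_ne (Nat.lt_succ_iff.1 hj) (hl j))⟩
      obtain ⟨l, rfl⟩ := hl
      have hstep : ∃ t : ℝ, t ^ 2 = 1 ∧
          ∀ i, ρ i < ρ l → s i * t * inner ℝ (v i) (v l) = G i l := by
        have hne : ∀ i, ρ i < ρ l → i ≠ l := fun i hi h ↦ hi.ne (congrArg ρ h)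
        by_cases hex : ∃ i, ρ i < ρ l ∧ G i l ≠ 0
        · obtain ⟨i, hil, hi⟩ := hex
          have h1 := hsq i l (hne i hil)
          have h0 : inner ℝ (v i) (v l) ≠ (0 : ℝ) := fun h0 ↦ by
            rw [h0] at h1
            exact pow_ne_zero 2 hi (by rw [← h1]; norm_num)
          refine ⟨s i * (G i l / inner ℝ (v i) (v l)), ?_, fun i' hi' ↦ ?_⟩
          · rw [mul_pow, hs, div_pow, h1, div_self (pow_ne_zero 2 hi), one_mul]
          · by_cases hG' : G i' l = 0
            · have h2 := hsq i' l (hne i' hi')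
              rw [hG', zero_pow two_ne_zero, sq_eq_zero_iff] at h2
              rw [h2, hG', mul_zero]
            · obtain rfl := htree i i' l hil hi' hi hG'
              have h3 := hs i
              field_simp
              rw [h3]
        · push Not at hex
          refine ⟨1, by norm_num, fun i hi ↦ ?_⟩
          have h2 := hsq i l (hne i hi)
          rw [hex i hi, zero_pow two_ne_zero, sq_eq_zero_iff] at h2
          rw [h2, hex i hi, mul_zero]
      obtain ⟨t, ht, htG⟩ := hstep
      refine ⟨Function.update s l t, fun i ↦ ?_, fun i j hij hj ↦ ?_⟩
      · by_cases hi : i = l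
        · rw [hi, Function.update_self, ht]
        · rw [Function.update_of_ne hi, hs]
      · have hjl : ρ j ≤ ρ l := Nat.lt_succ_iff.1 hj
        rw [Function.update_of_ne fun h ↦ (hij.trans_le hjl).ne (congrArg ρ h)]
        by_cases hj' : j = l
        · subst hj'
          rw [Function.update_self, htG i hij]
        · rw [Function.update_of_ne hj']
          exact hsG i j hij (lt_of_le_of_ne hjl fun h ↦ hj' (hρ h))
  obtain ⟨s, hs, hsG⟩ := key ((∑ i, ρ i) + 1)
  have hlt : ∀ i, ρ i < (∑ i, ρ i) + 1 := fun i ↦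
    Nat.lt_succ_iff.2 (Finset.single_le_sum (fun _ _ ↦ Nat.zero_le _) (Finset.mem_univ i))
  refine ⟨s, hs, fun i j hij ↦ ?_⟩
  rcases lt_or_gt_of_ne (hρ.ne hij) with h | h
  · exact hsG i j h (hlt j)
  · rw [hG, ← hsG j i h (hlt i), real_inner_comm, mul_comm (s i)]

/-- Unit roots can be rescaled so as to have a given Gram matrix, provided that the angles are
right up to sign and the graph is a forest. -/
lemma exists_roots_of_gram {r : ℕ} (n : Fin r → V) (hn : ∀ i, inner ℝ (n i) (n i) = (1 : ℝ))
    (hr : ∀ i, IsRoot W (n i)) (G : Fin r → Fin r → ℝ) (hG : ∀ i j, G i j = G j i)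
    {ρ : Fin r → ℕ} (hρ : Function.Injective ρ) (hpos : ∀ i, 0 < G i i)
    (hsq : ∀ i j, i ≠ j → inner ℝ (n i) (n j) ^ 2 * (G i i * G j j) = G i j ^ 2)
    (htree : ∀ i i' j, ρ i < ρ j → ρ i' < ρ j → G i j ≠ 0 → G i' j ≠ 0 → i = i') :
    ∃ α : Fin r → V, (∀ i, IsRoot W (α i)) ∧ ∀ i j, inner ℝ (α i) (α j) = G i j := by
  obtain ⟨s, hs, hsG⟩ := exists_signs (fun i ↦ √(G i i) • n i) G hG hρ (fun i j hij ↦ by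
    rw [inner_smul_left, inner_smul_right, RCLike.conj_to_real, ← hsq i j hij, mul_pow, mul_pow,
      Real.sq_sqrt (hpos i).le, Real.sq_sqrt (hpos j).le]
    ring) htree
  have hs0 : ∀ i, s i ≠ 0 := fun i h ↦ by simpa [h] using hs i
  refine ⟨fun i ↦ s i • √(G i i) • n i,
    fun i ↦ ((hr i).smul (Real.sqrt_pos.2 (hpos i)).ne').smul (hs0 i), fun i j ↦ ?_⟩
  by_cases hij : i = j
  · subst hij
    simp only [inner_smul_left, inner_smul_right, hn, RCLike.conj_to_real]
    linear_combination √(G i i) ^ 2 * hs i + Real.sq_sqrt (hpos i).le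
  · rw [← hsG i j hij]
    simp only [inner_smul_left, inner_smul_right, RCLike.conj_to_real]
    ring

/-! ### Computing with coordinates relative to simple roots -/

section Coordinates

variable {r : ℕ} {R : Type*} [CommRing R]

/-- The coordinates of the reflection of a vector in the simple root `i`, for the Cartan
matrix `A`. -/
def reflCoord (A : Fin r → Fin r → R) (i : Fin r) (c : Fin r → R) : Fin r → R :=
  fun l ↦ if l = i then c l - ∑ j, A i j * c j else c l

/-- The coordinates of the root obtained from the simple root `x.2` by the simple reflections
in the list `x.1`, the last one first. -/
def rootCoord (A : Fin r → Fin r → R) (x : List (Fin r) × Fin r) : Fin r → R :=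
  x.1.foldr (reflCoord A) (Pi.single x.2 1)

lemma refl_sum_smul (f : R →+* ℝ) {A G : Fin r → Fin r → R}
    (hAG : ∀ i j, 2 * G i j = A i j * G i i) {α : Fin r → V} (hα : ∀ i, α i ≠ 0)
    (hG : ∀ i j, inner ℝ (α i) (α j) = f (G i j)) (i : Fin r) (c : Fin r → R) :
    refl (α i) (∑ j, f (c j) • α j) = ∑ j, f (reflCoord A i c j) • α j := by
  have h1 : (2 * inner ℝ (α i) (∑ j, f (c j) • α j) / inner ℝ (α i) (α i) : ℝ) =
      f (∑ j, A i j * c j) := by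
    rw [div_eq_iff (by simpa using hα i), inner_sum, Finset.mul_sum, map_sum, Finset.sum_mul]
    refine Finset.sum_congr rfl fun j _ ↦ ?_
    have h2 := congrArg f (hAG i j)
    rw [map_mul, map_mul, map_ofNat] at h2
    rw [inner_smul_right, hG, hG, map_mul]
    linear_combination f (c j) * h2
  have h2 : ∀ j, f (reflCoord A i c j) • α j =
      f (c j) • α j - if j = i then f (∑ j, A i j * c j) • α i else 0 := by
    intro j
    rw [reflCoord]
    split_ifs with h
    · rw [h, map_sub, sub_smul]
    · rw [sub_zero]
  rw [refl_apply, h1, Finset.sum_congr rfl fun j _ ↦ h2 j, Finset.sum_sub_distrib,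
    Finset.sum_ite_eq' Finset.univ i, if_pos (Finset.mem_univ i)]

lemma isRoot_rootCoord (f : R →+* ℝ) {A G : Fin r → Fin r → R}
    (hAG : ∀ i j, 2 * G i j = A i j * G i i) {α : Fin r → V} (hα : ∀ i, IsRoot W (α i))
    (hG : ∀ i j, inner ℝ (α i) (α j) = f (G i j)) (x : List (Fin r) × Fin r) :
    IsRoot W (∑ j, f (rootCoord A x j) • α j) := by
  obtain ⟨w, i⟩ := x
  induction w with
  | nil =>
    have : ∑ j, f (rootCoord A ([], i) j) • α j = α i := by
      rw [Finset.sum_eq_single i]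
      · simp [rootCoord]
      · intro j _ hj
        simp [rootCoord, hj]
      · simp
    rw [this]
    exact hα i
  | cons l w ih =>
    have h := refl_sum_smul f hAG (fun i ↦ (hα i).1) hG l (rootCoord A (w, i))
    have h' : rootCoord A (l :: w, i) = reflCoord A l (rootCoord A (w, i)) := rfl
    rw [h', ← h]
    exact ih.refl (hα l)

/-- Orthogonality of roots can be checked in coordinates. -/
lemma exists_orthogonal_roots (f : R →+* ℝ) {A G : Fin r → Fin r → R}
    (hAG : ∀ i j, 2 * G i j = A i j * G i i) {α : Fin r → V} (hα : ∀ i, IsRoot W (α i))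
    (hG : ∀ i j, inner ℝ (α i) (α j) = f (G i j)) (x : Fin r → List (Fin r) × Fin r)
    (hx : ∀ p q, p ≠ q → ∑ i, ∑ j, rootCoord A (x p) i * G i j * rootCoord A (x q) j = 0) :
    ∃ β : Fin r → V, (∀ p, IsRoot W (β p)) ∧ Pairwise fun p q ↦ inner ℝ (β p) (β q) = 0 := by
  refine ⟨fun p ↦ ∑ j, f (rootCoord A (x p) j) • α j,
    fun p ↦ isRoot_rootCoord f hAG hα hG (x p), fun p q hpq ↦ ?_⟩
  have h := congrArg f (hx p q hpq)
  rw [map_sum, map_zero] at h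
  change inner ℝ (∑ j, f (rootCoord A (x p) j) • α j) (∑ j, f (rootCoord A (x q) j) • α j) = _
  rw [← h, sum_inner]
  refine Finset.sum_congr rfl fun i _ ↦ ?_
  rw [inner_sum, map_sum]
  refine Finset.sum_congr rfl fun j _ ↦ ?_
  rw [inner_smul_left, inner_smul_right, hG, map_mul, map_mul, RCLike.conj_to_real]
  ring

end Coordinates

/-! ### The listed types -/

/-- Unit normal vectors of the walls of a chamber, for a group of type `M`. If they can be used to
produce as many pairwise orthogonal roots, then the reflection in the intersection of all
hyperplanes lies in `W`. -/
lemma HasType.reflection_center_mem [Finite W] {B : Type*} [Fintype B] {M : CoxeterMatrix B}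
    (hT : HasType W M)
    (h : ∀ n : B → V, (∀ i, inner ℝ (n i) (n i) = (1 : ℝ)) → (∀ i, IsRoot W (n i)) →
      (∀ i j, orderOf (refl (n i) * refl (n j)) = M i j) →
      ∃ β : B → V, (∀ i, IsRoot W (β i)) ∧ Pairwise fun i j ↦ inner ℝ (β i) (β j) = 0) :
    (sInf (arrangement W) : Submodule ℝ V).reflection ∈ W := by
  obtain ⟨c, hc, e, he⟩ := hT
  have hex : ∀ i, ∃ v : V, inner ℝ v v = (1 : ℝ) ∧ (e i : Submodule ℝ V) = (ℝ ∙ v)ᗮ := by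
    intro i
    obtain ⟨u, hu, hue⟩ := (e i).2.1.1
    have hu' : ‖u‖ ≠ 0 := norm_ne_zero_iff.2 hu
    refine ⟨‖u‖⁻¹ • u, ?_, ?_⟩
    · rw [inner_smul_left, inner_smul_right, real_inner_self_eq_norm_sq, RCLike.conj_to_real]
      field_simp
    · rw [hue, Submodule.span_singleton_smul_eq (inv_ne_zero hu').isUnit]
  choose n hn hne using hex
  have hrefl : ∀ i, (e i : Submodule ℝ V).reflection = refl (n i) := fun i ↦ by
    simp only [hne, refl]
  have hroot : ∀ i, IsRoot W (n i) := by
    refine fun i ↦ ⟨fun h0 ↦ ?_, hrefl i ▸ (e i).2.1.2⟩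
    have := hn i
    rw [h0, inner_zero_left] at this
    exact zero_ne_one this
  obtain ⟨β, hβ, ho⟩ := h n hn hroot fun i j ↦ by rw [← hrefl, ← hrefl, he]
  exact FaceQuiver.reflection_center_mem hc e β hβ ho

/-- A criterion that reduces to computations with the Gram matrix `G` and the Cartan matrix `A`,
whose entries lie in a subring of `ℝ`. -/
lemma exists_orthogonal_roots_of_angles {r : ℕ} {R : Type*} [CommRing R] (f : R →+* ℝ)
    {A G : Fin r → Fin r → R} (hG : ∀ i j, G i j = G j i)
    (hAG : ∀ i j, 2 * G i j = A i j * G i i)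
    {ρ : Fin r → ℕ} (hρ : Function.Injective ρ)
    (htree : ∀ i i' j, ρ i < ρ j → ρ i' < ρ j → G i j ≠ 0 → G i' j ≠ 0 → i = i')
    (x : Fin r → List (Fin r) × Fin r)
    (hx : ∀ p q, p ≠ q → ∑ i, ∑ j, rootCoord A (x p) i * G i j * rootCoord A (x q) j = 0)
    (hpos : ∀ i, 0 < f (G i i)) (n : Fin r → V) (hn : ∀ i, inner ℝ (n i) (n i) = (1 : ℝ))
    (hr : ∀ i, IsRoot W (n i))
    (hsq : ∀ i j, i ≠ j → inner ℝ (n i) (n j) ^ 2 * (f (G i i) * f (G j j)) = f (G i j) ^ 2) :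
    ∃ β : Fin r → V, (∀ i, IsRoot W (β i)) ∧ Pairwise fun i j ↦ inner ℝ (β i) (β j) = 0 := by
  have h0 : ∀ {a : R}, f a ≠ 0 → a ≠ 0 := fun h h' ↦ h (by rw [h', map_zero])
  obtain ⟨α, hα, hαG⟩ := exists_roots_of_gram n hn hr (fun i j ↦ f (G i j))
    (fun i j ↦ by rw [hG]) hρ hpos hsq fun i i' j hi hi' h h' ↦ htree i i' j hi hi' (h0 h) (h0 h')
  exact exists_orthogonal_roots f hAG hα hαG x hx

/-- The exceptional types with an integral Gram matrix. -/
lemma HasType.reflection_center_mem_of_int [Finite W] {r : ℕ} {M : CoxeterMatrix (Fin r)}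
    (hT : HasType W M) (A G : Fin r → Fin r → ℤ) (hG : ∀ i j, G i j = G j i)
    (hAG : ∀ i j, 2 * G i j = A i j * G i i)
    {ρ : Fin r → ℕ} (hρ : Function.Injective ρ)
    (htree : ∀ i i' j, ρ i < ρ j → ρ i' < ρ j → G i j ≠ 0 → G i' j ≠ 0 → i = i')
    (x : Fin r → List (Fin r) × Fin r)
    (hx : ∀ p q, p ≠ q → ∑ i, ∑ j, rootCoord A (x p) i * G i j * rootCoord A (x q) j = 0)
    (hpos : ∀ i, 0 < G i i)
    (hM : ∀ i j, i ≠ j → Matrix.of.symm M.M i j = 2 ∧ G i j = 0 ∨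
      Matrix.of.symm M.M i j = 3 ∧ 4 * G i j ^ 2 = G i i * G j j ∨
      Matrix.of.symm M.M i j = 4 ∧ 2 * G i j ^ 2 = G i i * G j j) :
    (sInf (arrangement W) : Submodule ℝ V).reflection ∈ W := by
  refine hT.reflection_center_mem fun n hn hr ho ↦
    exists_orthogonal_roots_of_angles (Int.castRingHom ℝ) hG hAG hρ htree x hx
      (fun i ↦ by simpa using hpos i) n hn hr fun i j hij ↦ ?_
  simp only [Int.coe_castRingHom]
  rcases hM i j hij with ⟨h, h'⟩ | ⟨h, h'⟩ | ⟨h, h'⟩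
  · rw [inner_eq_zero_of_orderOf (hn i) (hn j) ((ho i j).trans h), h']
    simp
  · have h1 := four_inner_sq_of_orderOf (hn i) (hn j) ((ho i j).trans h)
    have h2 : 4 * (G i j : ℝ) ^ 2 = G i i * G j j := by exact_mod_cast h'
    linear_combination (h1 * (G i i * G j j : ℝ) - h2) / 4
  · have h1 := two_inner_sq_of_orderOf (hn i) (hn j) ((ho i j).trans h)
    have h2 : 2 * (G i j : ℝ) ^ 2 = G i i * G j j := by exact_mod_cast h'
    linear_combination (h1 * (G i i * G j j : ℝ) - h2) / 2

/-- The types `H₃` and `H₄`, with a Gram matrix over `ℤ[φ]`, where `φ² = φ + 1`. The angle between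
the walls `p` and `q` determines an embedding of `ℤ[φ]` into `ℝ`. -/
lemma HasType.reflection_center_mem_of_golden [Finite W] {r : ℕ} {M : CoxeterMatrix (Fin r)}
    (hT : HasType W M) (G : Fin r → Fin r → QuadraticAlgebra ℤ 1 1)
    (hG : ∀ i j, G i j = G j i)
    {ρ : Fin r → ℕ} (hρ : Function.Injective ρ)
    (htree : ∀ i i' j, ρ i < ρ j → ρ i' < ρ j → G i j ≠ 0 → G i' j ≠ 0 → i = i')
    (x : Fin r → List (Fin r) × Fin r)
    (hx : ∀ p q, p ≠ q → ∑ i, ∑ j, rootCoord G (x p) i * G i j * rootCoord G (x q) j = 0)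
    (hdiag : ∀ i, G i i = 2) {p q : Fin r} (hpq : M p q = 5)
    (hM : ∀ i j, i ≠ j → Matrix.of.symm M.M i j = 2 ∧ G i j = 0 ∨
      Matrix.of.symm M.M i j = 3 ∧ G i j = -1 ∨
      (i = p ∧ j = q ∨ i = q ∧ j = p) ∧ G i j = -QuadraticAlgebra.omega) :
    (sInf (arrangement W) : Submodule ℝ V).reflection ∈ W := by
  refine hT.reflection_center_mem fun n hn hr ho ↦ ?_
  obtain ⟨g, hg, hgi⟩ := exists_golden_of_orderOf (hn p) (hn q) (by rw [ho, hpq])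
  let f : QuadraticAlgebra ℤ 1 1 →ₐ[ℤ] ℝ :=
    QuadraticAlgebra.lift ⟨g, by rw [hg, one_smul, one_smul, add_comm]⟩
  have hf : f QuadraticAlgebra.omega = g := by simp [f]
  have hf2 : ∀ i, f (G i i) = 2 := fun i ↦ by rw [hdiag, map_ofNat]
  refine exists_orthogonal_roots_of_angles (f : QuadraticAlgebra ℤ 1 1 →+* ℝ) hG
      (fun i j ↦ by rw [hdiag, mul_comm]) hρ htree x hx (fun i ↦ ?_) n hn hr fun i j hij ↦ ?_
  · change 0 < f (G i i)
    rw [hf2]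
    norm_num
  · change _ * (f (G i i) * f (G j j)) = f (G i j) ^ 2
    rw [hf2, hf2]
    rcases hM i j hij with ⟨h, h'⟩ | ⟨h, h'⟩ | ⟨h, h'⟩
    · rw [inner_eq_zero_of_orderOf (hn i) (hn j) ((ho i j).trans h), h', map_zero]
      norm_num
    · have h1 := four_inner_sq_of_orderOf (hn i) (hn j) ((ho i j).trans h)
      rw [h', map_neg, map_one]
      linarith
    · rw [h', map_neg, hf]
      rcases h with ⟨rfl, rfl⟩ | ⟨rfl, rfl⟩
      · linarith
      · rw [real_inner_comm]
        linarith

section Exceptional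

variable [Finite W]

/-! In the following lemmas, the pair of a list `w` and an index `i` encodes the root obtained from
the simple root `i` by the simple reflections in `w`, the last one first. The pairs describe bases
of pairwise orthogonal roots, and this orthogonality is verified in coordinates. -/

/-- The nodes are taken in decreasing order, because in the numbering of the diagram the branch
node has two smaller neighbours but only one larger one. -/
lemma reflection_center_mem_E₇ (hT : HasType W CoxeterMatrix.E₇) :
    (sInf (arrangement W) : Submodule ℝ V).reflection ∈ W := by
  refine hT.reflection_center_mem_of_int (Matrix.of.symm CartanMatrix.E₇)
    (Matrix.of.symm CartanMatrix.E₇)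
    (ρ := fun i ↦ 7 - i)
    (by decide +kernel) (by decide +kernel) (by decide +kernel) (by decide +kernel)
    ![([], 1), ([3, 4, 2, 3], 1), ([5, 3, 4, 1, 3, 2], 0), ([4, 5, 2, 3, 4, 1, 3, 2], 0),
      ([6, 5, 2, 3, 4, 1, 3, 2], 0), ([6, 4, 5, 3, 4, 1, 3, 2], 0),
      ([5, 6, 4, 5, 3, 4, 2, 3], 1)]
    (by decide +kernel) (by decide +kernel) (by decide +kernel)

lemma reflection_center_mem_E₈ (hT : HasType W CoxeterMatrix.E₈) :
    (sInf (arrangement W) : Submodule ℝ V).reflection ∈ W := by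
  refine hT.reflection_center_mem_of_int (Matrix.of.symm CartanMatrix.E₈)
    (Matrix.of.symm CartanMatrix.E₈)
    (ρ := fun i ↦ 8 - i)
    (by decide +kernel) (by decide +kernel) (by decide +kernel) (by decide +kernel)
    ![([], 0), ([2, 3, 4, 1, 3, 2], 0), ([5, 6, 4, 5, 2, 3, 4, 1, 3, 2], 0),
      ([7, 5, 6, 3, 4, 5, 2, 3, 4, 1, 3, 2], 0),
      ([3, 4, 5, 6, 1, 3, 4, 5, 2, 3, 4, 1, 3, 2], 0),
      ([7, 4, 5, 6, 1, 3, 4, 5, 2, 3, 4, 1, 3, 2], 0),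
      ([6, 7, 5, 6, 1, 3, 4, 5, 2, 3, 4, 1, 3, 2], 0),
      ([6, 7, 4, 5, 6, 3, 4, 5, 2, 3, 4, 1, 3, 2], 0)]
    (by decide +kernel) (by decide +kernel) (by decide +kernel)

/-- The entries of the Gram matrix are scaled so that long roots have square norm `4` and short
roots have square norm `2`. -/
lemma reflection_center_mem_F₄ (hT : HasType W CoxeterMatrix.F₄) :
    (sInf (arrangement W) : Submodule ℝ V).reflection ∈ W := by
  refine hT.reflection_center_mem_of_int (ρ := fun i ↦ i)
    ![![2, -1, 0, 0], ![-1, 2, -1, 0], ![0, -2, 2, -1], ![0, 0, -1, 2]]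
    ![![4, -2, 0, 0], ![-2, 4, -2, 0], ![0, -2, 2, -1], ![0, 0, -1, 2]]
    (by decide +kernel) (by decide +kernel) (by decide +kernel) (by decide +kernel)
    ![([2], 1), ([3, 2], 1), ([2, 3, 0, 1], 2), ([1, 2, 3, 0, 1], 2)]
    (by decide +kernel) (by decide +kernel) (by decide +kernel)

/-- The Gram matrix, whose diagonal entries are `2`, is also the Cartan matrix. -/
lemma reflection_center_mem_H₃ (hT : HasType W CoxeterMatrix.H₃) :
    (sInf (arrangement W) : Submodule ℝ V).reflection ∈ W := by
  refine hT.reflection_center_mem_of_golden (ρ := fun i ↦ i) (p := 1) (q := 2)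
    ![![2, -1, 0], ![-1, 2, -QuadraticAlgebra.omega], ![0, -QuadraticAlgebra.omega, 2]]
    (by decide +kernel) (by decide +kernel) (by decide +kernel)
    ![([2], 1), ([1, 2, 1], 0), ([0, 1, 2], 1)]
    (by decide +kernel) (by decide +kernel) (by decide +kernel) (by decide +kernel)

lemma reflection_center_mem_H₄ (hT : HasType W CoxeterMatrix.H₄) :
    (sInf (arrangement W) : Submodule ℝ V).reflection ∈ W := by
  refine hT.reflection_center_mem_of_golden (ρ := fun i ↦ i) (p := 2) (q := 3)
    ![![2, -1, 0, 0], ![-1, 2, -1, 0], ![0, -1, 2, -QuadraticAlgebra.omega],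
      ![0, 0, -QuadraticAlgebra.omega, 2]]
    (by decide +kernel) (by decide +kernel) (by decide +kernel)
    ![([], 3), ([2, 3, 2, 3, 1, 2, 3, 2, 1], 0), ([1, 2, 3, 2, 3, 0, 1, 2, 3, 2, 1], 0),
      ([0, 1, 2, 3, 2, 3, 1, 2, 3, 2, 1], 0)]
    (by decide +kernel) (by decide +kernel) (by decide +kernel) (by decide +kernel)

end Exceptional

lemma reflection_center_mem_A₁ [Finite W] (hT : HasType W (CoxeterMatrix.A 1)) :
    (sInf (arrangement W) : Submodule ℝ V).reflection ∈ W :=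
  hT.reflection_center_mem fun n _ hr _ ↦ ⟨n, hr, Subsingleton.pairwise⟩

/-- In a dihedral group, the elements `(s t) ^ m s` are reflections. -/
lemma exists_refl_eq_pow_mul {a b : V} (ha : IsRoot W a) (hb : IsRoot W b)
    (ha1 : inner ℝ a a = (1 : ℝ)) (hb1 : inner ℝ b b = (1 : ℝ)) : ∀ m : ℕ,
    ∃ v, IsRoot W v ∧ inner ℝ v v = (1 : ℝ) ∧ (refl a * refl b) ^ m * refl a = refl v
  | 0 => ⟨a, ha, ha1, by simp⟩
  | 1 => ⟨refl a b, hb.refl ha, by rw [LinearIsometryEquiv.inner_map_map, hb1], by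
      rw [refl_map, pow_one, refl, refl, Submodule.reflection_inv]⟩
  | m + 2 => by
    obtain ⟨v, hv, hv1, h⟩ := exists_refl_eq_pow_mul ha hb ha1 hb1 m
    refine ⟨(refl a * refl b) v, hv.map (W.mul_mem ha.2 hb.2),
      by rw [LinearIsometryEquiv.inner_map_map, hv1], ?_⟩
    have hinv : (refl a * refl b)⁻¹ = refl b * refl a := by
      rw [mul_inv_rev, refl, refl, Submodule.reflection_inv, Submodule.reflection_inv]
    rw [refl_map, ← h, hinv, pow_succ, pow_succ']
    simp only [mul_assoc]

/-- If `s t` has even order `2 (m + 1)`, then `(s t) ^ (m + 1) s` is a reflection that commutes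
with `s`. -/
lemma reflection_center_mem_I [Finite W] {m : ℕ} (hT : HasType W (CoxeterMatrix.I (2 * m))) :
    (sInf (arrangement W) : Submodule ℝ V).reflection ∈ W := by
  refine hT.reflection_center_mem fun n hn hr ho ↦ ?_
  obtain ⟨v, hv, hv1, h⟩ := exists_refl_eq_pow_mul (hr 0) (hr 1) (hn 0) (hn 1) (m + 1)
  have ho' : orderOf (refl (n 0) * refl (n 1)) = 2 * (m + 1) := by
    rw [ho]
    rfl
  have hord : orderOf (refl v * refl (n 0)) = 2 := by
    have : refl (n 0) * refl (n 0) = 1 := Submodule.reflection_mul_reflection _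
    rw [← h, mul_assoc, this, mul_one]
    refine orderOf_eq_prime ?_ fun h1 ↦ ?_
    · rw [← pow_mul, mul_comm, ← ho', pow_orderOf_eq_one]
    · have := orderOf_le_of_pow_eq_one (by omega) h1
      omega
  have h0 := inner_eq_zero_of_orderOf hv1 (hn 0) hord
  refine ⟨![v, n 0], fun i ↦ ?_, fun i j hij ↦ ?_⟩
  · fin_cases i
    · exact hv
    · exact hr 0
  · fin_cases i <;> fin_cases j <;> first | exact absurd rfl hij | exact h0 | skip
    rw [real_inner_comm]
    exact h0

/-! ### The types `B_n` and `D_n` -/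

section Chain

/-- Vectors `e 0, a 1, a 2, …, a (N - 1)` with the inner products of the standard simple roots
`x₀, x₁ - x₀, x₂ - x₁, …` of type `B_N`. -/
structure IsChain (N : ℕ) (e a : ℕ → V) : Prop where
  succ : ∀ i, e (i + 1) = e i + a (i + 1)
  zero_zero : 0 < N → inner ℝ (e 0) (e 0) = (1 : ℝ)
  zero_one : 1 < N → inner ℝ (e 0) (a 1) = (-1 : ℝ)
  zero_far : ∀ j, 1 < j → j < N → inner ℝ (e 0) (a j) = (0 : ℝ)
  self : ∀ i, 0 < i → i < N → inner ℝ (a i) (a i) = (2 : ℝ)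
  next : ∀ i, 0 < i → i + 1 < N → inner ℝ (a i) (a (i + 1)) = (-1 : ℝ)
  far : ∀ i j, 0 < i → i + 1 < j → j < N → inner ℝ (a i) (a j) = (0 : ℝ)

variable {N : ℕ} {e a : ℕ → V}

lemma IsChain.inner_later (h : IsChain N e a) (i : ℕ) (hi : i < N) :
    inner ℝ (e i) (e i) = (1 : ℝ) ∧ (i + 1 < N → inner ℝ (e i) (a (i + 1)) = (-1 : ℝ)) ∧
      ∀ j, i + 1 < j → j < N → inner ℝ (e i) (a j) = (0 : ℝ) := by
  induction i with
  | zero => exact ⟨h.zero_zero hi, h.zero_one, h.zero_far⟩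
  | succ i ih =>
    obtain ⟨h1, h2, h3⟩ := ih (by omega)
    refine ⟨?_, fun hi' ↦ ?_, fun j hij hj ↦ ?_⟩
    · rw [h.succ, inner_add_left, inner_add_right, inner_add_right, h1, h2 hi,
        real_inner_comm, h2 hi, h.self _ (by omega) hi]
      norm_num
    · rw [h.succ, inner_add_left, h3 _ (by omega) hi', h.next _ (by omega) hi']
      norm_num
    · rw [h.succ, inner_add_left, h3 _ (by omega) hj, h.far _ _ (by omega) hij hj]
      norm_num

lemma IsChain.inner_eq_zero (h : IsChain N e a) {i j : ℕ} (hij : i < j) (hj : j < N) :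
    inner ℝ (e i) (e j) = (0 : ℝ) := by
  induction j with
  | zero => omega
  | succ j ih =>
    obtain ⟨h1, h2, h3⟩ := h.inner_later i (by omega)
    rw [h.succ, inner_add_right]
    rcases (Nat.lt_succ_iff.1 hij).eq_or_lt with rfl | hlt
    · rw [h1, h2 hj]
      norm_num
    · rw [ih hlt (by omega), h3 _ (by omega) hj]
      norm_num

lemma IsChain.inner_eq (h : IsChain N e a) {i j : ℕ} (hi : i < N) (hj : j < N) :
    inner ℝ (e i) (e j) = if i = j then (1 : ℝ) else 0 := by
  split_ifs with hij
  · subst hij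
    exact (h.inner_later i hi).1
  · rcases lt_or_gt_of_ne hij with hlt | hlt
    · exact h.inner_eq_zero hlt hj
    · rw [real_inner_comm]
      exact h.inner_eq_zero hlt hi

lemma refl_eq_add {u v : V} (hu : inner ℝ u u = (2 : ℝ)) (h : inner ℝ u v = (-1 : ℝ)) :
    refl u v = v + u := by
  rw [refl_apply, hu, h]
  module

/-- In type `B_N`, the orthonormal vectors `e i` are roots. -/
lemma IsChain.isRoot (h : IsChain N e a) (h0 : 0 < N → IsRoot W (e 0))
    (ha : ∀ i, 0 < i → i < N → IsRoot W (a i)) (i : ℕ) (hi : i < N) : IsRoot W (e i) := by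
  induction i with
  | zero => exact h0 hi
  | succ i ih =>
    have h1 := (ih (by omega)).refl (ha (i + 1) (by omega) hi)
    rw [refl_eq_add (h.self _ (by omega) hi)
      (by rw [real_inner_comm]; exact (h.inner_later i (by omega)).2.1 hi)] at h1
    rwa [h.succ]

/-- In type `D_N`, the sums of consecutive orthonormal vectors are roots. -/
lemma IsChain.isRoot_add (h : IsChain N e a) (h0 : 1 < N → IsRoot W (e 1 + e 0))
    (ha : ∀ i, 0 < i → i < N → IsRoot W (a i)) (i : ℕ) (hi : i + 1 < N) :
    IsRoot W (e (i + 1) + e i) := by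
  induction i with
  | zero => exact h0 hi
  | succ i ih =>
    have h1 := ((ih (by omega)).refl (ha (i + 2) (by omega) hi)).refl (ha (i + 1) (by omega)
      (by omega))
    have h2 := (h.inner_later i (by omega)).2.2 (i + 2) (by omega) hi
    have h3 := (h.inner_later (i + 1) (by omega)).2.1 hi
    have h4 : a (i + 1) = e (i + 1) - e i := by rw [h.succ, add_sub_cancel_left]
    rw [refl_eq_add (v := e (i + 1) + e i) (h.self _ (by omega) hi)
        (by rw [real_inner_comm, inner_add_left, h2, h3]; norm_num),
      show e (i + 1) + e i + a (i + 2) = e (i + 2) + e i by rw [h.succ (i + 1)]; abel,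
      refl_eq_add (h.self _ (by omega) (by omega)), h4,
      show e (i + 2) + e i + (e (i + 1) - e i) = e (i + 1 + 1) + e (i + 1) by abel] at h1
    · exact h1
    · rw [h4, inner_sub_left, inner_add_right, inner_add_right, h.inner_eq (by omega) (by omega),
        h.inner_eq (by omega) (by omega), h.inner_eq (by omega) (by omega),
        h.inner_eq (by omega) (by omega), if_neg (by omega), if_neg (by omega), if_neg (by omega),
        if_pos rfl]
      norm_num

end Chain

variable [Finite W]

/-- The vectors `e i` with `e 0 = v` and `e (i + 1) = e i + a (i + 1)`. -/
def partialSum (v : V) (a : ℕ → V) : ℕ → V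
  | 0 => v
  | i + 1 => partialSum v a i + a (i + 1)

/-- The diagram is numbered with the short root last, so that `a i` is the simple root
`N - 1 - i`. -/
lemma reflection_center_mem_B {N : ℕ} (hT : HasType W (CoxeterMatrix.B N)) :
    (sInf (arrangement W) : Submodule ℝ V).reflection ∈ W := by
  refine hT.reflection_center_mem fun n hn hr ho ↦ ?_
  let G : Fin N → Fin N → ℝ := fun i j ↦ if i = j then (if (i : ℕ) + 1 = N then 1 else 2) else
    if (j : ℕ) + 1 = i ∨ (i : ℕ) + 1 = j then -1 else 0
  have hM : ∀ i j : Fin N, CoxeterMatrix.B N i j = if i = j then 1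
      else (if (i : ℕ) = N - 1 ∧ (j : ℕ) = N - 2 ∨ (j : ℕ) = N - 1 ∧ (i : ℕ) = N - 2 then 4
        else (if (j : ℕ) + 1 = i ∨ (i : ℕ) + 1 = j then 3 else 2)) := fun _ _ ↦ rfl
  obtain ⟨α, hα, hG⟩ := exists_roots_of_gram n hn hr G
    (fun i j ↦ by
      by_cases hij : i = j
      · rw [hij]
      · simp only [G, if_neg hij, if_neg (Ne.symm hij), or_comm])
    Fin.val_injective
    (fun i ↦ by simp only [G, if_true]; split_ifs <;> norm_num)
    (fun i j hij ↦ by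
      have h := ho i j
      rw [hM, if_neg hij] at h
      have hij' : (i : ℕ) ≠ j := fun h ↦ hij (Fin.ext h)
      have hi := i.2
      have hj := j.2
      simp only [G, if_true, if_neg hij]
      split_ifs at h with h1 h2
      · have h3 := two_inner_sq_of_orderOf (hn i) (hn j) h
        rw [if_pos (c := (j : ℕ) + 1 = i ∨ _) (by omega)]
        by_cases h4 : (i : ℕ) + 1 = N
        · rw [if_pos h4, if_neg (by omega)]
          linarith
        · rw [if_neg h4, if_pos (by omega)]
          linarith
      · have h3 := four_inner_sq_of_orderOf (hn i) (hn j) h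
        rw [if_pos h2, if_neg (by omega), if_neg (by omega)]
        linarith
      · rw [inner_eq_zero_of_orderOf (hn i) (hn j) h, if_neg h2]
        norm_num)
    (fun i i' j hi hi' h h' ↦ by
      simp only [G] at h h'
      rw [if_neg (fun h ↦ hi.ne (congrArg Fin.val h))] at h
      rw [if_neg (fun h ↦ hi'.ne (congrArg Fin.val h))] at h'
      have h1 : (j : ℕ) + 1 = i ∨ (i : ℕ) + 1 = j := by by_contra hc; exact h (if_neg hc)
      have h2 : (j : ℕ) + 1 = i' ∨ (i' : ℕ) + 1 = j := by by_contra hc; exact h' (if_neg hc)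
      exact Fin.ext (by omega))
  let a : ℕ → V := fun i ↦ if h : i < N then α ⟨N - 1 - i, by omega⟩ else 0
  have ha : ∀ i (h : i < N), a i = α ⟨N - 1 - i, by omega⟩ := fun i h ↦ dif_pos h
  have haG : ∀ i j, i < N → j < N → inner ℝ (a i) (a j) = if i = j then (if i = 0 then 1 else 2)
      else if i + 1 = j ∨ j + 1 = i then (-1 : ℝ) else 0 := by
    intro i j hi hj
    rw [ha i hi, ha j hj, hG]
    simp only [G, Fin.mk.injEq]
    congr 1
    · exact propext (by omega)
    · congr 1
      exact propext (by omega)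
    · congr 1
      exact propext (by omega)
  have hchain : IsChain N (partialSum (a 0) a) a := by
    refine ⟨fun _ ↦ rfl, fun h ↦ ?_, fun h ↦ ?_, fun j h1 h ↦ ?_, fun i h1 h ↦ ?_,
      fun i h1 h ↦ ?_, fun i j h1 h2 h ↦ ?_⟩
    · rw [partialSum, haG _ _ h h, if_pos rfl, if_pos rfl]
    · rw [partialSum, haG _ _ (by omega) h, if_neg (by omega), if_pos (by omega)]
    · rw [partialSum, haG _ _ (by omega) h, if_neg (by omega), if_neg (by omega)]
    · rw [haG _ _ h h, if_pos rfl, if_neg (by omega)]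
    · rw [haG _ _ (by omega) h, if_neg (by omega), if_pos (by omega)]
    · rw [haG _ _ (by omega) h, if_neg (by omega), if_neg (by omega)]
  refine ⟨fun i ↦ partialSum (a 0) a i, fun i ↦ hchain.isRoot (fun h ↦ ?_) (fun j _ hj ↦ ?_) i i.2,
    fun i j hij ↦ ?_⟩
  · rw [partialSum, ha 0 h]
    exact hα _
  · rw [ha j hj]
    exact hα _
  · change inner ℝ _ _ = (0 : ℝ)
    rw [hchain.inner_eq i.2 j.2, if_neg (fun h ↦ hij (Fin.ext h))]

/-- For orthonormal vectors `e 0, …, e (N - 1)` such that the `e i ± e j` are roots, the vectors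
`e (2 * i + 1) + e (2 * i)` and `e (2 * i + 1) - e (2 * i)` are pairwise orthogonal roots, and there
are `N` of them if `N` is even. The simple roots `a 0` and `a 1` are the ends of the fork of the
diagram, and `e 0 = (a 0 - a 1) / 2`. -/
lemma reflection_center_mem_D {N : ℕ} (hN : Even N) (hT : HasType W (typeD N)) :
    (sInf (arrangement W) : Submodule ℝ V).reflection ∈ W := by
  refine hT.reflection_center_mem fun n hn hr ho ↦ ?_
  let adj : ℕ → ℕ → Prop := fun i j ↦ (i + 1 = j ∧ j + 1 < N) ∨ (j + 1 = i ∧ i + 1 < N) ∨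
      (i + 3 = N ∧ j + 1 = N) ∨ (j + 3 = N ∧ i + 1 = N)
  have hadj : ∀ i j, adj i j → adj j i := fun i j h ↦ by simp only [adj] at h ⊢; omega
  let G : Fin N → Fin N → ℝ := fun i j ↦ if i = j then 2 else if adj i j then -1 else 0
  have hM : ∀ i j : Fin N, typeD N i j = if i = j then 1 else if adj i j then 3 else 2 :=
    fun _ _ ↦ rfl
  obtain ⟨α, hα, hG⟩ := exists_roots_of_gram n hn hr G
    (fun i j ↦ by
      by_cases hij : i = j
      · rw [hij]
      · have h : adj i j ↔ adj j i := ⟨hadj _ _, hadj _ _⟩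
        simp only [G, if_neg hij, if_neg (Ne.symm hij), h])
    Fin.val_injective
    (fun i ↦ by simp only [G, if_true]; norm_num)
    (fun i j hij ↦ by
      have h := ho i j
      rw [hM, if_neg hij] at h
      simp only [G, if_true, if_neg hij]
      by_cases h1 : adj i j
      · rw [if_pos h1] at h ⊢
        linarith [four_inner_sq_of_orderOf (hn i) (hn j) h]
      · rw [if_neg h1] at h ⊢
        rw [inner_eq_zero_of_orderOf (hn i) (hn j) h]
        norm_num)
    (fun i i' j hi hi' h h' ↦ by
      simp only [G] at h h'
      rw [if_neg (fun h ↦ hi.ne (congrArg Fin.val h))] at h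
      rw [if_neg (fun h ↦ hi'.ne (congrArg Fin.val h))] at h'
      have h1 : adj i j := by by_contra hc; exact h (if_neg hc)
      have h2 : adj i' j := by by_contra hc; exact h' (if_neg hc)
      simp only [adj] at h1 h2
      exact Fin.ext (by omega))
  let a : ℕ → V := fun i ↦ if h : i < N then α ⟨N - 1 - i, by omega⟩ else 0
  have ha : ∀ i (h : i < N), a i = α ⟨N - 1 - i, by omega⟩ := fun i h ↦ dif_pos h
  have haG : ∀ i j, i < N → j < N → inner ℝ (a i) (a j) = if i = j then 2
      else if adj (N - 1 - i) (N - 1 - j) then (-1 : ℝ) else 0 := by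
    intro i j hi hj
    rw [ha i hi, ha j hj, hG]
    simp only [G, Fin.mk.injEq]
    congr 1
    exact propext (by omega)
  have hself : ∀ i, i < N → inner ℝ (a i) (a i) = (2 : ℝ) := fun i hi ↦ by
    rw [haG i i hi hi, if_pos rfl]
  have hzero : ∀ i j, i < N → j < N → i ≠ j → ¬ adj (N - 1 - i) (N - 1 - j) →
      inner ℝ (a i) (a j) = (0 : ℝ) := fun i j hi hj h h' ↦ by
    rw [haG i j hi hj, if_neg h, if_neg h']
  have hone : ∀ i j, i < N → j < N → i ≠ j → adj (N - 1 - i) (N - 1 - j) →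
      inner ℝ (a i) (a j) = (-1 : ℝ) := fun i j hi hj h h' ↦ by
    rw [haG i j hi hj, if_neg h, if_pos h']
  have hN2 : 0 < N → 1 < N := fun h ↦ by obtain ⟨m, hm⟩ := hN; omega
  have h01 : 1 < N → inner ℝ (a 0) (a 1) = (0 : ℝ) := fun h ↦
    hzero _ _ (by omega) h (by omega) (by simp only [adj]; omega)
  have hchain : IsChain N (partialSum ((1 / 2 : ℝ) • (a 0 - a 1)) a) a := by
    refine ⟨fun _ ↦ rfl, fun h ↦ ?_, fun h ↦ ?_, fun j h1 h ↦ ?_, fun i h1 h ↦ hself i h,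
      fun i h1 h ↦ ?_, fun i j h1 h2 h ↦ ?_⟩
    · rw [partialSum, inner_smul_left, inner_smul_right, inner_sub_left, inner_sub_right,
        inner_sub_right, real_inner_comm (a 0) (a 1), h01 (hN2 h), hself 0 h, hself 1 (hN2 h)]
      norm_num
    · rw [partialSum, inner_smul_left, inner_sub_left, h01 h, hself 1 h]
      norm_num
    · rw [partialSum, inner_smul_left, inner_sub_left]
      by_cases hj : j = 2
      · rw [hone 0 j (by omega) h (by omega) (by simp only [adj]; omega),
          hone 1 j (by omega) h (by omega) (by simp only [adj]; omega), sub_self, mul_zero]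
      · rw [hzero 0 j (by omega) h (by omega) (by simp only [adj]; omega),
          hzero 1 j (by omega) h (by omega) (by simp only [adj]; omega), sub_self, mul_zero]
    · exact hone _ _ (by omega) h (by omega) (by simp only [adj]; omega)
    · exact hzero _ _ (by omega) h (by omega) (by simp only [adj]; omega)
  set e := partialSum ((1 / 2 : ℝ) • (a 0 - a 1)) a
  have ha' : ∀ i, i < N → IsRoot W (a i) := fun i hi ↦ by
    rw [ha i hi]
    exact hα _
  have hadd : ∀ i, i + 1 < N → IsRoot W (e (i + 1) + e i) := hchain.isRoot_add
    (fun h ↦ by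
      have h1 : e 1 + e 0 = a 0 := by
        simp only [e, partialSum]
        module
      rw [h1]
      exact ha' 0 (by omega))
    (fun i _ hi ↦ ha' i hi)
  have hsub : ∀ i, i + 1 < N → IsRoot W (e (i + 1) - e i) := fun i hi ↦ by
    rw [hchain.succ, add_sub_cancel_left]
    exact ha' _ hi
  have heven : ∀ i, i < N → i % 2 = 0 → i + 1 < N := fun i hi h ↦ by
    obtain ⟨m, hm⟩ := hN
    omega
  refine ⟨fun i ↦ if (i : ℕ) % 2 = 0 then e (i + 1) + e i else e i - e (i - 1), fun i ↦ ?_,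
    fun i j hij ↦ ?_⟩
  · by_cases h : (i : ℕ) % 2 = 0
    · simp only [if_pos h]
      exact hadd i (heven i i.2 h)
    · simp only [if_neg h]
      have h1 := hsub (i - 1) (by have := i.2; omega)
      rwa [show (i : ℕ) - 1 + 1 = i by omega] at h1
  · have hij' : (i : ℕ) ≠ j := fun h ↦ hij (Fin.ext h)
    have hi := i.2
    have hj := j.2
    have hi' := heven i hi
    have hj' := heven j hj
    by_cases h : (i : ℕ) % 2 = 0 <;> by_cases h' : (j : ℕ) % 2 = 0 <;>
      simp only [h, h', if_true, if_false, inner_add_left, inner_add_right, inner_sub_left,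
        inner_sub_right] <;>
      rw [hchain.inner_eq (by omega) (by omega), hchain.inner_eq (by omega) (by omega),
        hchain.inner_eq (by omega) (by omega), hchain.inner_eq (by omega) (by omega)] <;>
      split_ifs <;> first | omega | norm_num

end FaceQuiver

end

theorem mainTheorem9 {V : Type*} [NormedAddCommGroup V] [InnerProductSpace ℝ V]
    [FiniteDimensional ℝ V] (W : Subgroup (V ≃ₗᵢ[ℝ] V)) [Finite W]
    (hW : FaceQuiver.IsReflectionGroup W) (hT : FaceQuiver.HasListedType W)
    {k : Type*} [Field k] (hk : (Nat.card W : k) ≠ 0) (ℓ : FaceQuiver.EllFamily k W)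
    (O' O : FaceQuiver.Orbit W) :
    (Odd ((O'.rank : ℤ) - (O.rank : ℤ)) → ℓ.arrows O' O = 0) ∧
      (O ⋖ O' → ℓ.arrows O' O = 0) := by
  have hC : (sInf (FaceQuiver.arrangement W) : Submodule ℝ V).reflection ∈ W := by
    rcases hT with h | ⟨n, h⟩ | ⟨n, h⟩ | h | h | h | ⟨n, h⟩ | h | h
    · exact FaceQuiver.reflection_center_mem_A₁ h
    · exact FaceQuiver.reflection_center_mem_B h
    · exact FaceQuiver.reflection_center_mem_D (even_two_mul n) h
    · exact FaceQuiver.reflection_center_mem_E₇ h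
    · exact FaceQuiver.reflection_center_mem_E₈ h
    · exact FaceQuiver.reflection_center_mem_F₄ h
    · exact FaceQuiver.reflection_center_mem_I h
    · exact FaceQuiver.reflection_center_mem_H₃ h
    · exact FaceQuiver.reflection_center_mem_H₄ h
  refine ⟨fun hodd ↦ FaceQuiver.arrows_eq_zero hk ℓ hC hodd, fun hcov ↦
    FaceQuiver.arrows_eq_zero hk ℓ hC ?_⟩
  rw [FaceQuiver.Orbit.rank_of_covBy hcov]
  simp
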